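/- Let $\Omega\subset\mathbb R^2\setminus\{(0,0)\}$ be an open cone with vertex at the origin (a nonempty connected open set with $\lambda\Omega\subset\Omega$ for all $\lambda>0$) that does not meet the $y$-axis $\{x=0\}$. Let $(u,v,p)\in C^\infty(\Omega)^3$ be a solution in $\Omega$ of the stationary Navier–Stokes equations $$\operatorname{div}(\mathbf U\otimes\mathbf U)-\Delta\mathbf U+\nabla p=0,\qquad \operatorname{div}\mathbf U=0,\qquad \mathbf U=(u,v),$$ which is nontrivial ($\mathbf U\not\equiv0$), self-similar, i.e. $\mathbf U(x,y)=\lambda\,\mathbf U(\lambda x,\lambda y)$ and $p(x,y)=\lambda^2p(\lambda x,\lambda y)$ for all $\lambda>0$ and $(x,y)\in\Omega$, and radial, i.e. $xv=yu$ in $\Omega$. Then there are real constants $C_1,C_2$ and a function $\kappa$ such that in $\Omega$ $$u=\frac{x\,\kappa}{x^2+y^2},\qquad v=\frac{y\,\kappa}{x^2+y^2},\qquad p=\frac{2\kappa+C_1}{x^2+y^2},$$ and one of the following holds. Here $\theta=\arctan(y/x)$, $\mathcal P_3(t)=t^3+6t^2+6C_1t+C_2$, $L_\pm(C_1)=12C_1-16\pm4(2-C_1)\sqrt{2(2-C_1)}$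 for $C_1<2$, $C$ is a real constant, and $\mathrm{am}(\cdot,k)$, $0\le k<1$, is the Jacobi amplitude with modulus $k$, the inverse function of $\varphi\mapsto\int_0^\varphi(1-k^2\sin^2 t)^{-1/2}\,dt$. Each formula for $\kappa$ is well defined at every point of $\Omega$ (no pole of $\cot$, $\tan$, $\coth$ and no zero of the denominator is met). 1. (Singular solution) $\kappa= C$ is constant, with $\mathcal P_3(C)=0$ and $2C+C_1=-C^2/2$, so that $p=-\dfrac{C^2}{2(x^2+y^2)}$. 2. (Region I) $C_1>2$, or $C_1=2$ and $C_2\ne8$, or $C_1<2$ and ($C_2>L_+(C_1)$ or $C_2<L_-(C_1)$); and $$\kappa=\alpha-\beta\cot^2\!\Big(\tfrac12\,\mathrm{am}\Big(\tfrac{\sqrt{6\beta}}3\,\theta+\sqrt\beta\,C,\ \sqrt{\tfrac{\beta-m+\alpha}{2\beta}}\Big)\Big),$$ where $\mathcal P_3(t)=(t-\alpha)\big((t-m)^2+n^2\big)$ with $\alpha,m,n$ real, $n\neq0$, and $\beta=\sqrt{(m-\alpha)^2+n^2}$. 3. (Point $P_0$) $(C_1,C_2)=(2,8)$ and $\kappa=-2-\dfrac{6}{(\theta+C)^2}$.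 4. (Region II) $C_1<2$ and $L_-(C_1)<C_2<L_+(C_1)$; and, with $a<b<c$ the three real roots of $\mathcal P_3$ and $\psi=\mathrm{am}\Big(\sqrt{\tfrac{c-a}{6}}\,\theta+\sqrt{c-a}\,C,\ \sqrt{\tfrac{c-b}{c-a}}\Big)$, either $\kappa=c-(c-b)\sin^2\psi$ in all of $\Omega$ or $\kappa=a-(b-a)\tan^2\psi$ in all of $\Omega$. 5. (Curve $\Gamma_+$) $C_1<2$, $C_2=L_+(C_1)$ and $$\kappa=-2-2\sqrt{2(2-C_1)}-3\sqrt{2(2-C_1)}\,\tan^2\!\Big(\sqrt[4]{\tfrac{2-C_1}{2}}\,\theta+C\Big).$$ 6. (Curve $\Gamma_-$) $C_1<2$, $C_2=L_-(C_1)$ and, with $\psi=\tfrac{\sqrt[4]{2-C_1}}2\big(\sqrt[4]8\,\theta+C\big)$, either $\kappa=-2+2\sqrt{2(2-C_1)}-3\sqrt{2(2-C_1)}\,\tanh^2\psi$ in all of $\Omega$ or $\kappa=-2+2\sqrt{2(2-C_1)}-3\sqrt{2(2-C_1)}\,\coth^2\psi$ in all of $\Omega$. -/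

import Mathlib

open scoped ContDiff

noncomputable section

/-- The partial derivative in the first variable `x`. -/
def partialX (f : ℝ × ℝ → ℝ) (q : ℝ × ℝ) : ℝ := fderiv ℝ f q (1, 0)

/-- The partial derivative in the second variable `y`. -/
def partialY (f : ℝ × ℝ → ℝ) (q : ℝ × ℝ) : ℝ := fderiv ℝ f q (0, 1)

/-- The Laplacian in the plane. -/
def laplacian2 (f : ℝ × ℝ → ℝ) (q : ℝ × ℝ) : ℝ :=
  partialX (partialX f) q + partialY (partialY f) q

/-- An open cone with vertex at the origin in the punctured plane: a nonempty connected open set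
that is invariant under all positive dilations (an open sector). -/
structure IsOpenCone (Ω : Set (ℝ × ℝ)) : Prop where
  isOpen : IsOpen Ω
  isConnected : IsConnected Ω
  zero_notMem : (0 : ℝ × ℝ) ∉ Ω
  smul_mem : ∀ l : ℝ, 0 < l → ∀ q ∈ Ω, l • q ∈ Ω

/-- The unforced stationary incompressible Navier–Stokes equations
`div (U ⊗ U) - Δ U + ∇ p = 0`, `div U = 0` in `Ω`, with velocity `U = (u, v)` and pressure `p`. -/
structure SolvesNavierStokes (Ω : Set (ℝ × ℝ)) (u v p : ℝ × ℝ → ℝ) : Prop where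
  momentumX : ∀ q ∈ Ω,
    partialX (fun r => u r * u r) q + partialY (fun r => u r * v r) q
      - laplacian2 u q + partialX p q = 0
  momentumY : ∀ q ∈ Ω,
    partialX (fun r => v r * u r) q + partialY (fun r => v r * v r) q
      - laplacian2 v q + partialY p q = 0
  divFree : ∀ q ∈ Ω, partialX u q + partialY v q = 0

/-- `(U, p)` equals its rescaling `(l U(l ·), l² p(l ·))` in the cone `Ω` for every `l > 0`. -/
def IsSelfSimilar (Ω : Set (ℝ × ℝ)) (u v p : ℝ × ℝ → ℝ) : Prop :=
  ∀ l : ℝ, 0 < l → ∀ q ∈ Ω,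
    u q = l * u (l • q) ∧ v q = l * v (l • q) ∧ p q = l ^ 2 * p (l • q)

/-- The incomplete elliptic integral of the first kind `F(φ, k)` with modulus `k`. -/
def ellipticF (φ k : ℝ) : ℝ := ∫ θ in (0 : ℝ)..φ, 1 / √(1 - k ^ 2 * Real.sin θ ^ 2)

/-- The Jacobi amplitude `am(·, k)`: the inverse function of `F(·, k)`, which for `0 ≤ k < 1` is a
bijection of the real line. -/
def jacobiAm (m k : ℝ) : ℝ := Function.invFun (fun φ => ellipticF φ k) m

/-- For `0 ≤ k < 1` the function `F(·, k)` is a bijection of the real line. -/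
theorem ellipticF_bijective {k : ℝ} (h0 : 0 ≤ k) (h1 : k < 1) :
    Function.Bijective (fun φ => ellipticF φ k) := by
  have hk : k ^ 2 < 1 := by nlinarith
  have hs : ∀ θ : ℝ, 0 < 1 - k ^ 2 * Real.sin θ ^ 2 := fun θ => by
    nlinarith [Real.sin_sq_le_one θ, sq_nonneg (Real.sin θ), sq_nonneg k]
  have hc : Continuous (fun θ : ℝ => 1 / √(1 - k ^ 2 * Real.sin θ ^ 2)) := by
    refine continuous_const.div (by fun_prop) fun θ => (Real.sqrt_pos.2 (hs θ)).ne'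
  have hge : ∀ θ : ℝ, 1 ≤ 1 / √(1 - k ^ 2 * Real.sin θ ^ 2) := fun θ => by
    rw [le_div_iff₀ (Real.sqrt_pos.2 (hs θ)), one_mul]
    refine Real.sqrt_le_one.2 ?_
    nlinarith [mul_nonneg (sq_nonneg k) (sq_nonneg (Real.sin θ))]
  have hd : ∀ a b : ℝ, a ≤ b → b - a ≤ ellipticF b k - ellipticF a k := fun a b hab => by
    unfold ellipticF
    rw [intervalIntegral.integral_interval_sub_left (hc.intervalIntegrable _ _)
      (hc.intervalIntegrable _ _)]
    have := intervalIntegral.integral_mono_on hab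
      (continuous_const.intervalIntegrable (μ := MeasureTheory.volume) (u := fun _ => (1 : ℝ)) a b)
      (hc.intervalIntegrable a b) (fun x _ => hge x)
    simpa using this
  have hF0 : ellipticF 0 k = 0 := by simp [ellipticF]
  have hcont : Continuous (fun φ => ellipticF φ k) :=
    intervalIntegral.continuous_primitive (fun a b => hc.intervalIntegrable a b) 0
  constructor
  · have : StrictMono (fun φ => ellipticF φ k) := fun a b hab => by
      have := hd a b hab.le
      show ellipticF a k < ellipticF b k
      linarith
    exact this.injective
  · refine hcont.surjective ?_ ?_
    · refine Filter.tendsto_atTop_mono' _ ?_ Filter.tendsto_id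
      filter_upwards [Filter.eventually_ge_atTop 0] with b hb
      have := hd 0 b hb
      simp only [id]; linarith
    · refine Filter.tendsto_atBot_mono' _ ?_ Filter.tendsto_id
      filter_upwards [Filter.eventually_le_atBot 0] with b hb
      have := hd b 0 hb
      simp only [id]; linarith

/-- The defining relation of the Jacobi amplitude: `m = F(am(m, k), k)` for `0 ≤ k < 1`. -/
theorem ellipticF_jacobiAm {k : ℝ} (h0 : 0 ≤ k) (h1 : k < 1) (m : ℝ) :
    ellipticF (jacobiAm m k) k = m :=
  Function.rightInverse_invFun (ellipticF_bijective h0 h1).2 m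

/-- The hyperbolic cotangent (meaningful for `t ≠ 0`). -/
def hypCoth (t : ℝ) : ℝ := Real.cosh t / Real.sinh t

/-- The cubic polynomial `𝒫₃(h) = h³ + 6h² + 6C₁h + C₂`. -/
def cubicP (C₁ C₂ h : ℝ) : ℝ := h ^ 3 + 6 * h ^ 2 + 6 * C₁ * h + C₂

/-- The curve `L₊`. -/
def curveLPlus (C₁ : ℝ) : ℝ := 12 * C₁ - 16 + 4 * (2 - C₁) * √(2 * (2 - C₁))

/-- The curve `L₋`. -/
def curveLMinus (C₁ : ℝ) : ℝ := 12 * C₁ - 16 - 4 * (2 - C₁) * √(2 * (2 - C₁))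

/-- The region `I = I₁ ∪ Γ₀ ∪ I₂` of the parameter plane. -/
def regionI : Set (ℝ × ℝ) :=
  {c | 2 < c.1} ∪ {c | c.1 = 2 ∧ c.2 ≠ 8} ∪
    {c | c.1 < 2 ∧ (curveLPlus c.1 < c.2 ∨ c.2 < curveLMinus c.1)}

/-- The point `P₀` of the parameter plane. -/
def pointP0 : Set (ℝ × ℝ) := {(2, 8)}

/-- The region `II` of the parameter plane. -/
def regionII : Set (ℝ × ℝ) :=
  {c | c.1 < 2 ∧ curveLMinus c.1 < c.2 ∧ c.2 < curveLPlus c.1}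

/-- The curve `Γ₊` in the parameter plane. -/
def gammaPlus : Set (ℝ × ℝ) := {c | c.1 < 2 ∧ c.2 = curveLPlus c.1}

/-- The curve `Γ₋` in the parameter plane. -/
def gammaMinus : Set (ℝ × ℝ) := {c | c.1 < 2 ∧ c.2 = curveLMinus c.1}

/-- The polar angle modulo `π`, `θ(x, y) = arctan (y / x)`, for `x ≠ 0`. -/
def angleOf (q : ℝ × ℝ) : ℝ := Real.arctan (q.2 / q.1)

/-- Singular solution: `κ = C` is constant. The constant is a root of `𝒫₃`, and the pressure
`(2C + C₁)/(x² + y²)` equals `-C²/(2(x² + y²))`. -/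
def ProfileConst (Ω : Set (ℝ × ℝ)) (C₁ C₂ : ℝ) (κ : ℝ × ℝ → ℝ) : Prop :=
  ∃ C : ℝ, cubicP C₁ C₂ C = 0 ∧ 2 * C + C₁ = -C ^ 2 / 2 ∧ ∀ q ∈ Ω, κ q = C

/-- Region `I`: `𝒫₃` has the real root `α` and the non-real roots `m ± n i`, and
`κ = α - β cot² (am(√(6β)/3 · θ + √β C, √((β - m + α)/(2β))) / 2)` with `β = √((m - α)² + n²)`,
the argument of `cot` avoiding the poles. -/
def ProfileI (Ω : Set (ℝ × ℝ)) (C₁ C₂ : ℝ) (κ : ℝ × ℝ → ℝ) : Prop :=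
  (C₁, C₂) ∈ regionI ∧ ∃ α m n β C : ℝ, n ≠ 0 ∧
    (∀ t : ℝ, cubicP C₁ C₂ t = (t - α) * ((t - m) ^ 2 + n ^ 2)) ∧
    β = √((m - α) ^ 2 + n ^ 2) ∧
    ∃ ψ : ℝ × ℝ → ℝ,
      (∀ q, ψ q =
        1 / 2 * jacobiAm (√(6 * β) / 3 * angleOf q + √β * C) √((β - m + α) / (2 * β))) ∧
      ∀ q ∈ Ω, Real.sin (ψ q) ≠ 0 ∧ κ q = α - β * Real.cot (ψ q) ^ 2

/-- The point `P₀`: `κ = -2 - 6/(θ + C)²`, the denominator being nonzero. -/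
def ProfileP0 (Ω : Set (ℝ × ℝ)) (C₁ C₂ : ℝ) (κ : ℝ × ℝ → ℝ) : Prop :=
  (C₁, C₂) ∈ pointP0 ∧ ∃ C : ℝ, ∀ q ∈ Ω,
    angleOf q + C ≠ 0 ∧ κ q = -2 - 6 / (angleOf q + C) ^ 2

/-- Region `II`: `𝒫₃` has the real roots `a < b < c`, and either
`κ = c - (c - b) sin² ψ` or `κ = a - (b - a) tan² ψ` (with `cos ψ ≠ 0`), where
`ψ = am(√((c - a)/6) θ + √(c - a) C, √((c - b)/(c - a)))`. -/
def ProfileII (Ω : Set (ℝ × ℝ)) (C₁ C₂ : ℝ) (κ : ℝ × ℝ → ℝ) : Prop :=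
  (C₁, C₂) ∈ regionII ∧ ∃ a b c C : ℝ, a < b ∧ b < c ∧
    (∀ t : ℝ, cubicP C₁ C₂ t = (t - a) * (t - b) * (t - c)) ∧
    ∃ ψ : ℝ × ℝ → ℝ,
      (∀ q, ψ q = jacobiAm (√((c - a) / 6) * angleOf q + √(c - a) * C)
        √((c - b) / (c - a))) ∧
      ((∀ q ∈ Ω, κ q = c - (c - b) * Real.sin (ψ q) ^ 2) ∨
        (∀ q ∈ Ω, Real.cos (ψ q) ≠ 0 ∧ κ q = a - (b - a) * Real.tan (ψ q) ^ 2))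

/-- The curve `Γ₊`: with `s = √(2(2 - C₁))`,
`κ = -2 - 2s - 3s tan² (((2 - C₁)/2)^(1/4) θ + C)`, away from the poles of `tan`. -/
def ProfileGammaPlus (Ω : Set (ℝ × ℝ)) (C₁ C₂ : ℝ) (κ : ℝ × ℝ → ℝ) : Prop :=
  (C₁, C₂) ∈ gammaPlus ∧ ∃ C : ℝ, ∃ ψ : ℝ × ℝ → ℝ,
    (∀ q, ψ q = ((2 - C₁) / 2) ^ (1 / 4 : ℝ) * angleOf q + C) ∧
    ∀ q ∈ Ω, Real.cos (ψ q) ≠ 0 ∧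
      κ q = -2 - 2 * √(2 * (2 - C₁)) - 3 * √(2 * (2 - C₁)) * Real.tan (ψ q) ^ 2

/-- The curve `Γ₋`: with `s = √(2(2 - C₁))` and `ψ = (2 - C₁)^(1/4)/2 · (8^(1/4) θ + C)`, either
`κ = -2 + 2s - 3s tanh² ψ` or `κ = -2 + 2s - 3s coth² ψ` (with `ψ ≠ 0`). -/
def ProfileGammaMinus (Ω : Set (ℝ × ℝ)) (C₁ C₂ : ℝ) (κ : ℝ × ℝ → ℝ) : Prop :=
  (C₁, C₂) ∈ gammaMinus ∧ ∃ C : ℝ, ∃ ψ : ℝ × ℝ → ℝ,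
    (∀ q, ψ q = (2 - C₁) ^ (1 / 4 : ℝ) / 2 * ((8 : ℝ) ^ (1 / 4 : ℝ) * angleOf q + C)) ∧
    ((∀ q ∈ Ω,
        κ q = -2 + 2 * √(2 * (2 - C₁)) - 3 * √(2 * (2 - C₁)) * Real.tanh (ψ q) ^ 2) ∨
      (∀ q ∈ Ω, ψ q ≠ 0 ∧
        κ q = -2 + 2 * √(2 * (2 - C₁)) - 3 * √(2 * (2 - C₁)) * hypCoth (ψ q) ^ 2))

/-- The classification of the profile functions `κ` on `Ω` with parameters `(C₁, C₂)`. -/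
def IsListedProfile (Ω : Set (ℝ × ℝ)) (C₁ C₂ : ℝ) (κ : ℝ × ℝ → ℝ) : Prop :=
  ProfileConst Ω C₁ C₂ κ ∨ ProfileI Ω C₁ C₂ κ ∨ ProfileP0 Ω C₁ C₂ κ ∨
    ProfileII Ω C₁ C₂ κ ∨ ProfileGammaPlus Ω C₁ C₂ κ ∨ ProfileGammaMinus Ω C₁ C₂ κ

end

/-!
In polar coordinates a self-similar radial field is `U = (x, y) f(θ) / r²`, with pressure
`p = P(θ) / r²`. It is divergence free for every `f`, and the angular and the radial component of
the momentum equation read `P' = 2f'` and `f'' = -f² - 2P` (`profile_ode_of_solvesNavierStokes`).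
So `P = 2f + C₁`, and `f` solves the autonomous equation `f'' = -f² - 4f - 2C₁`, whose energy
integral is `f'² = -(2/3) 𝒫₃(f)`; its value defines `C₂` (`exists_isProfileOn`).

The solutions are found by matching rather than by quadrature. In every region of the
`(C₁, C₂)`-plane each function of the list has the form `G ∘ φ`, with `G` an even elementary
function and `φ` a phase with `φ' = W(φ)`: an affine function, or the Jacobi amplitude, for which
`W = ω √(1 - k² sin²)`. One checks that `G ∘ φ` solves the equation with the same energy. At a
single angle the constant `C` in the phase is chosen so that `G ∘ φ` takes the value of `f`, which
is possible because `𝒫₃(f) ≤ 0`; the derivatives then agree up to sign, and the sign is corrected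
by `φ ↦ -φ` (`IsProfileOn.exists_phase`). Uniqueness for the Cauchy problem propagates the equality
over the whole interval of angles. The formula meets no pole on the way, since `f` stays bounded
near every angle of the interval (`profile_eqOn_of_poles`). Solutions through a multiple root
of `𝒫₃` are constant, which is the singular solution.

The real roots of `𝒫₃` needed in each region come from the shifted form
`h³ - 3s²h + (C₂ + 6s² - 8)`, where `h = t + 2` and `s² = 2(2 - C₁)`: for
`C₁ < 2` one of its critical values, at `h = ±s`, vanishes exactly on the curves `C₂ = L±(C₁)`.
-/

open Filter Topology Set

/-! ### The profile equation and continuation of its solutions -/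

/-- Two solutions of `f'' = -f² - 4f - 2C₁` with the same data at a point agree near it. -/
theorem profile_eventuallyEq {C₁ t₀ : ℝ} {f f₁ g g₁ : ℝ → ℝ}
    (hf : ∀ᶠ t in 𝓝 t₀, HasDerivAt f (f₁ t) t)
    (hf₁ : ∀ᶠ t in 𝓝 t₀, HasDerivAt f₁ (-f t ^ 2 - 4 * f t - 2 * C₁) t)
    (hg : ∀ᶠ t in 𝓝 t₀, HasDerivAt g (g₁ t) t)
    (hg₁ : ∀ᶠ t in 𝓝 t₀, HasDerivAt g₁ (-g t ^ 2 - 4 * g t - 2 * C₁) t)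
    (h₀ : f t₀ = g t₀) (h₁ : f₁ t₀ = g₁ t₀) :
    ∀ᶠ t in 𝓝 t₀, f t = g t ∧ f₁ t = g₁ t := by
  let F : ℝ × ℝ → ℝ × ℝ := fun z => (z.2, -z.1 ^ 2 - 4 * z.1 - 2 * C₁)
  have hF : ContDiff ℝ 1 F := by fun_prop
  obtain ⟨K, s, hs, hK⟩ :=
    (hF.contDiffAt (x := (f t₀, f₁ t₀))).exists_lipschitzOnWith
  have key := ODE_solution_unique_of_eventually (v := fun _ => F) (s := fun _ => s) (K := K)
    (f := fun t => (f t, f₁ t)) (g := fun t => (g t, g₁ t)) (t₀ := t₀)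
    (Eventually.of_forall fun _ => hK) ?_ ?_ (by simp [h₀, h₁])
  · filter_upwards [key] with t ht
    exact Prod.ext_iff.1 ht
  · have hc : ContinuousAt (fun t => (f t, f₁ t)) t₀ :=
      hf.self_of_nhds.continuousAt.prodMk hf₁.self_of_nhds.continuousAt
    filter_upwards [hf, hf₁, hc.eventually hs] with t h h' h'' using ⟨h.prodMk h', h''⟩
  · have hc : ContinuousAt (fun t => (g t, g₁ t)) t₀ :=
      hg.self_of_nhds.continuousAt.prodMk hg₁.self_of_nhds.continuousAt
    rw [h₀, h₁] at hs
    filter_upwards [hg, hg₁, hc.eventually hs] with t h h' h'' using ⟨h.prodMk h', h''⟩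

/-- A solution `f` on an interval that agrees to first order at one point with a solution `g`
having poles agrees with `g` everywhere, and meets no pole. The poles are the zeros of `D`, and
`g = N / D` elsewhere, where `N` and `D` have no common zero. -/
theorem profile_eqOn_of_poles {C₁ : ℝ} {I : Set ℝ} (hI : IsOpen I) (hIc : IsPreconnected I)
    {f f₁ g g₁ N D : ℝ → ℝ}
    (hf : ∀ t ∈ I, HasDerivAt f (f₁ t) t)
    (hf₁ : ∀ t ∈ I, HasDerivAt f₁ (-f t ^ 2 - 4 * f t - 2 * C₁) t)
    (hN : Continuous N) (hD : Continuous D) (hND : ∀ t, D t = 0 → N t ≠ 0)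
    (hgND : ∀ t, D t ≠ 0 → g t * D t = N t)
    (hg : ∀ t, D t ≠ 0 → HasDerivAt g (g₁ t) t)
    (hg₁ : ∀ t, D t ≠ 0 → HasDerivAt g₁ (-g t ^ 2 - 4 * g t - 2 * C₁) t)
    {t₀ : ℝ} (ht₀ : t₀ ∈ I) (hD₀ : D t₀ ≠ 0) (h₀ : f t₀ = g t₀) (h₁ : f₁ t₀ = g₁ t₀) :
    ∀ t ∈ I, D t ≠ 0 ∧ f t = g t := by
  let S : Set ℝ := {t | t ∈ I ∧ D t ≠ 0 ∧ f t = g t ∧ f₁ t = g₁ t}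
  have hSo : IsOpen S := by
    rw [isOpen_iff_mem_nhds]
    rintro t ⟨htI, htD, e₀, e₁⟩
    have hnI : ∀ᶠ r in 𝓝 t, r ∈ I := hI.mem_nhds htI
    have hnD : ∀ᶠ r in 𝓝 t, D r ≠ 0 := hD.continuousAt.eventually_ne htD
    have := profile_eventuallyEq (hnI.mono hf) (hnI.mono hf₁) (hnD.mono hg) (hnD.mono hg₁) e₀ e₁
    filter_upwards [hnI, hnD, this] with r h1 h2 h3 using ⟨h1, h2, h3⟩
  have hSc : closure S ∩ I ⊆ S := by
    rintro t ⟨htS, htI⟩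
    have hfr : ∃ᶠ r in 𝓝 t, r ∈ S := mem_closure_iff_frequently.1 htS
    have hfc := (hf t htI).continuousAt
    have lim : ∀ {a b : ℝ → ℝ}, ContinuousAt a t → ContinuousAt b t → (∀ r ∈ S, a r = b r) →
        a t = b t := fun {a b} ha hb hab => by
      by_contra hne
      exact hfr ((ha.ne_iff_eventually_ne hb).1 hne |>.mono fun r hr hrS => hr (hab r hrS))
    have hfD : f t * D t = N t :=
      lim (a := fun r => f r * D r) (hfc.mul hD.continuousAt) hN.continuousAt
        fun r hr => by simp only [hr.2.2.1, hgND r hr.2.1]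
    -- At a zero of `D` the relation `f D = N` would make `N` vanish too.
    have htD : D t ≠ 0 := fun h => hND t h (by rw [← hfD, h, mul_zero])
    exact ⟨htI, htD, lim hfc (hg t htD).continuousAt fun r hr => hr.2.2.1,
      lim (hf₁ t htI).continuousAt (hg₁ t htD).continuousAt fun r hr => hr.2.2.2⟩
  have := hIc.subset_of_closure_inter_subset hSo ⟨t₀, ht₀, ht₀, hD₀, h₀, h₁⟩ hSc
  exact fun t ht => ⟨(this ht).2.1, (this ht).2.2.1⟩

/-- A nonempty open interval `I` with a solution `f` of the profile equation
`f'' = -f² - 4f - 2C₁` at energy level `f'² = -(2/3) 𝒫₃(f)`; `f₁` is the derivative of `f`. -/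
structure IsProfileOn (C₁ C₂ : ℝ) (I : Set ℝ) (f f₁ : ℝ → ℝ) : Prop where
  isOpen : IsOpen I
  isPreconnected : IsPreconnected I
  nonempty : I.Nonempty
  hasDerivAt : ∀ t ∈ I, HasDerivAt f (f₁ t) t
  hasDerivAt_deriv : ∀ t ∈ I, HasDerivAt f₁ (-f t ^ 2 - 4 * f t - 2 * C₁) t
  energy : ∀ t ∈ I, f₁ t ^ 2 = -(2 / 3) * cubicP C₁ C₂ (f t)

theorem IsProfileOn.cubicP_nonpos {C₁ C₂ : ℝ} {I : Set ℝ} {f f₁ : ℝ → ℝ}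
    (h : IsProfileOn C₁ C₂ I f f₁) {t : ℝ} (ht : t ∈ I) : cubicP C₁ C₂ (f t) ≤ 0 := by
  nlinarith [h.energy t ht, sq_nonneg (f₁ t)]

/-- A solution through an equilibrium (a multiple root of `𝒫₃`) is constant. -/
theorem IsProfileOn.const_of_equilibrium {C₁ C₂ : ℝ} {I : Set ℝ} {f f₁ : ℝ → ℝ}
    (h : IsProfileOn C₁ C₂ I f f₁) {e t₀ : ℝ} (he : cubicP C₁ C₂ e = 0)
    (he' : e ^ 2 + 4 * e + 2 * C₁ = 0) (ht₀ : t₀ ∈ I) (h₀ : f t₀ = e) : ∀ t ∈ I, f t = e := by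
  have h₁ : f₁ t₀ = 0 := by
    have := h.energy t₀ ht₀
    rw [h₀, he, mul_zero] at this
    exact pow_eq_zero_iff two_ne_zero |>.1 this
  have := profile_eqOn_of_poles h.isOpen h.isPreconnected (g := fun _ => e) (g₁ := fun _ => 0)
    (N := fun _ => e) (D := fun _ => 1) h.hasDerivAt h.hasDerivAt_deriv continuous_const
    continuous_const (by simp) (by simp) (fun t _ => hasDerivAt_const t e)
    (fun t _ => (hasDerivAt_const t (0 : ℝ)).congr_deriv (by linarith))
    ht₀ one_ne_zero h₀ h₁
  exact fun t ht => (this t ht).2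

/-- If `f = G ∘ φ` is an even function `G` of a phase `φ` which obeys `φ' = W(φ)` and can be made to
take any value at any point, and if `G ∘ φ` solves the profile equation at the energy level of `f`,
then matching the value of `f` at one point is enough: the energy fixes `f'` up to sign, and
`φ ↦ -φ` changes the sign of the derivative of `G ∘ φ`. -/
theorem IsProfileOn.exists_phase {C₁ C₂ : ℝ} {I : Set ℝ} {f f₁ : ℝ → ℝ}
    (h : IsProfileOn C₁ C₂ I f f₁) {W W₁ G G₁ G₂ N D : ℝ → ℝ} {φ : ℝ → ℝ → ℝ}
    (hφ : ∀ C t, HasDerivAt (φ C) (W (φ C t)) t) (hφs : ∀ t x, ∃ C, φ C t = x)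
    (hW : ∀ x, HasDerivAt W (W₁ x) x) (hWe : ∀ x, W (-x) = W x)
    (hN : Continuous N) (hD : Continuous D) (hND : ∀ x, D x = 0 → N x ≠ 0)
    (hGND : ∀ x, D x ≠ 0 → G x * D x = N x)
    (hG : ∀ x, D x ≠ 0 → HasDerivAt G (G₁ x) x) (hG₁ : ∀ x, D x ≠ 0 → HasDerivAt G₁ (G₂ x) x)
    (hDe : ∀ x, D x ≠ 0 → D (-x) ≠ 0) (hGe : ∀ x, G (-x) = G x) (hGo : ∀ x, G₁ (-x) = -G₁ x)
    (hode : ∀ x, D x ≠ 0 →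
      G₂ x * W x ^ 2 + G₁ x * (W x * W₁ x) = -G x ^ 2 - 4 * G x - 2 * C₁)
    (hen : ∀ x, D x ≠ 0 → G₁ x ^ 2 * W x ^ 2 = -(2 / 3) * cubicP C₁ C₂ (G x))
    {t₀ : ℝ} (ht₀ : t₀ ∈ I) (hx : ∃ x, D x ≠ 0 ∧ G x = f t₀) :
    ∃ C, ∀ t ∈ I, D (φ C t) ≠ 0 ∧ f t = G (φ C t) := by
  obtain ⟨x, hDx, hGx, h₁⟩ : ∃ x, D x ≠ 0 ∧ f t₀ = G x ∧ f₁ t₀ = G₁ x * W x := by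
    obtain ⟨x, hDx, hGx⟩ := hx
    have : f₁ t₀ ^ 2 = (G₁ x * W x) ^ 2 := by rw [h.energy t₀ ht₀, ← hGx, mul_pow, hen x hDx]
    rcases sq_eq_sq_iff_eq_or_eq_neg.1 this with h' | h'
    · exact ⟨x, hDx, hGx.symm, h'⟩
    · exact ⟨-x, hDe x hDx, by rw [hGe, hGx], by rw [hGo, hWe, h']; ring⟩
  obtain ⟨C, rfl⟩ := hφs t₀ x
  have hφc : Continuous (φ C) := continuous_iff_continuousAt.2 fun t => (hφ C t).continuousAt
  refine ⟨C, profile_eqOn_of_poles h.isOpen h.isPreconnected h.hasDerivAt h.hasDerivAt_deriv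
    (hN.comp hφc) (hD.comp hφc) (fun t => hND _) (fun t => hGND _)
    (g₁ := fun t => G₁ (φ C t) * W (φ C t)) (fun t ht => (hG _ ht).comp t (hφ C t))
    (fun t ht => ?_) ht₀ hDx hGx h₁⟩
  rw [← hode _ ht]
  exact (((hG₁ _ ht).comp t (hφ C t)).mul ((hW _).comp t (hφ C t))).congr_deriv (by
    simp only [Function.comp_apply]
    ring)

/-! ### The Jacobi amplitude -/

theorem one_sub_sq_mul_sin_sq_pos {k : ℝ} (h0 : 0 ≤ k) (h1 : k < 1) (x : ℝ) :
    0 < 1 - k ^ 2 * Real.sin x ^ 2 := by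
  nlinarith [Real.sin_sq_le_one x, sq_nonneg (Real.sin x), sq_nonneg k]

theorem hasDerivAt_ellipticF {k : ℝ} (h0 : 0 ≤ k) (h1 : k < 1) (x : ℝ) :
    HasDerivAt (fun φ => ellipticF φ k) (1 / √(1 - k ^ 2 * Real.sin x ^ 2)) x := by
  have hc : Continuous (fun θ : ℝ => 1 / √(1 - k ^ 2 * Real.sin θ ^ 2)) :=
    continuous_const.div (by fun_prop) fun θ =>
      (Real.sqrt_pos.2 (one_sub_sq_mul_sin_sq_pos h0 h1 θ)).ne'
  exact intervalIntegral.integral_hasDerivAt_right (hc.intervalIntegrable _ _)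
    (hc.stronglyMeasurableAtFilter _ _) hc.continuousAt

theorem jacobiAm_ellipticF {k : ℝ} (h0 : 0 ≤ k) (h1 : k < 1) (x : ℝ) :
    jacobiAm (ellipticF x k) k = x :=
  Function.leftInverse_invFun (ellipticF_bijective h0 h1).1 x

theorem continuous_jacobiAm {k : ℝ} (h0 : 0 ≤ k) (h1 : k < 1) :
    Continuous (fun m => jacobiAm m k) := by
  have hF : StrictMono (fun φ => ellipticF φ k) :=
    strictMono_of_hasDerivAt_pos (hasDerivAt_ellipticF h0 h1) fun x =>
      one_div_pos.2 (Real.sqrt_pos.2 (one_sub_sq_mul_sin_sq_pos h0 h1 x))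
  refine Monotone.continuous_of_surjective (fun a b hab => ?_)
    fun x => ⟨_, jacobiAm_ellipticF h0 h1 x⟩
  rw [← hF.le_iff_le]
  simpa only [ellipticF_jacobiAm h0 h1] using hab

theorem hasDerivAt_jacobiAm {k : ℝ} (h0 : 0 ≤ k) (h1 : k < 1) (m : ℝ) :
    HasDerivAt (fun m => jacobiAm m k) √(1 - k ^ 2 * Real.sin (jacobiAm m k) ^ 2) m := by
  have hpos := Real.sqrt_pos.2 (one_sub_sq_mul_sin_sq_pos h0 h1 (jacobiAm m k))
  have := HasDerivAt.of_local_left_inverse (continuous_jacobiAm h0 h1).continuousAt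
    (hasDerivAt_ellipticF h0 h1 (jacobiAm m k)) (one_div_pos.2 hpos).ne'
    (Eventually.of_forall fun y => ellipticF_jacobiAm h0 h1 y)
  simpa using this

/-- A rescaled speed of the Jacobi amplitude, as a function of the rescaled amplitude. -/
theorem hasDerivAt_jacobiAm_speed {k : ℝ} (h0 : 0 ≤ k) (h1 : k < 1) (c a x : ℝ) :
    HasDerivAt (fun x => c * √(1 - k ^ 2 * Real.sin (a * x) ^ 2))
      (-(c * a * k ^ 2 * Real.sin (a * x) * Real.cos (a * x)) /
        √(1 - k ^ 2 * Real.sin (a * x) ^ 2)) x := by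
  have hpos := one_sub_sq_mul_sin_sq_pos h0 h1 (a * x)
  have := (((((hasDerivAt_id x).const_mul a).sin.pow 2).const_mul (k ^ 2)).const_sub 1
    |>.sqrt hpos.ne').const_mul c
  refine this.congr_deriv ?_
  have := Real.sqrt_pos.2 hpos
  simp only [Pi.pow_apply, id]
  field_simp
  norm_num
  ring

theorem jacobiAm_speed_sq {k : ℝ} (h0 : 0 ≤ k) (h1 : k < 1) (c y : ℝ) :
    (c * √(1 - k ^ 2 * Real.sin y ^ 2)) ^ 2 = c ^ 2 * (1 - k ^ 2 * Real.sin y ^ 2) := by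
  rw [mul_pow, Real.sq_sqrt (one_sub_sq_mul_sin_sq_pos h0 h1 y).le]

theorem jacobiAm_speed_mul_deriv {k : ℝ} (h0 : 0 ≤ k) (h1 : k < 1) (c a y : ℝ) :
    c * √(1 - k ^ 2 * Real.sin y ^ 2) *
      (-(c * a * k ^ 2 * Real.sin y * Real.cos y) / √(1 - k ^ 2 * Real.sin y ^ 2)) =
      -(c ^ 2 * a * k ^ 2 * Real.sin y * Real.cos y) := by
  have := (Real.sqrt_pos.2 (one_sub_sq_mul_sin_sq_pos h0 h1 y)).ne'
  field_simp

/-- The phase `am(c t + σ C)` can be made to take any value at any point. -/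
theorem exists_jacobiAm_eq {k σ : ℝ} (h0 : 0 ≤ k) (h1 : k < 1) (hσ : σ ≠ 0) (c t x : ℝ) :
    ∃ C, jacobiAm (c * t + σ * C) k = x :=
  ⟨(ellipticF x k - c * t) / σ, by
    rw [mul_div_cancel₀ _ hσ, add_sub_cancel, jacobiAm_ellipticF h0 h1]⟩

theorem hasDerivAt_jacobiAm_affine {k : ℝ} (h0 : 0 ≤ k) (h1 : k < 1) (c σ t : ℝ) :
    HasDerivAt (fun t => jacobiAm (c * t + σ) k)
      (c * √(1 - k ^ 2 * Real.sin (jacobiAm (c * t + σ) k) ^ 2)) t := by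
  have := (hasDerivAt_jacobiAm h0 h1 (c * t + σ)).comp t
    (((hasDerivAt_id t).const_mul c).add_const σ)
  exact this.congr_deriv (by ring)

/-! ### The profile functions of the list and their derivatives -/

theorem hasDerivAt_cot_sq {x : ℝ} (hx : Real.sin x ≠ 0) :
    HasDerivAt (fun x => Real.cot x ^ 2) (-2 * (Real.cos x / Real.sin x ^ 3)) x := by
  have := ((Real.hasDerivAt_cos x).div (Real.hasDerivAt_sin x) hx).pow 2
  simp only [Real.cot_eq_cos_div_sin]
  refine this.congr_deriv ?_
  simp only [Pi.div_apply, Nat.cast_ofNat, Nat.add_one_sub_one, pow_one]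
  field_simp
  linear_combination (-Real.cos x) * Real.sin_sq_add_cos_sq x

theorem hasDerivAt_cos_div_sin_cube {x : ℝ} (hx : Real.sin x ≠ 0) :
    HasDerivAt (fun x => Real.cos x / Real.sin x ^ 3)
      (-(3 - 2 * Real.sin x ^ 2) / (Real.sin x ^ 2) ^ 2) x := by
  refine ((Real.hasDerivAt_cos x).div ((Real.hasDerivAt_sin x).pow 3)
    (pow_ne_zero 3 hx)).congr_deriv ?_
  simp only [Pi.pow_apply]
  field_simp
  norm_num
  linear_combination (-3 * Real.sin x ^ 2) * Real.sin_sq_add_cos_sq x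

theorem hasDerivAt_tan_sq {x : ℝ} (hx : Real.cos x ≠ 0) :
    HasDerivAt (fun x => Real.tan x ^ 2) (2 * (Real.sin x / Real.cos x ^ 3)) x := by
  refine ((Real.hasDerivAt_tan hx).pow 2).congr_deriv ?_
  simp only [Real.tan_eq_sin_div_cos, Nat.cast_ofNat, Nat.add_one_sub_one, pow_one]
  field_simp

theorem hasDerivAt_sin_div_cos_cube {x : ℝ} (hx : Real.cos x ≠ 0) :
    HasDerivAt (fun x => Real.sin x / Real.cos x ^ 3)
      ((3 - 2 * Real.cos x ^ 2) / (Real.cos x ^ 2) ^ 2) x := by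
  refine ((Real.hasDerivAt_sin x).div ((Real.hasDerivAt_cos x).pow 3)
    (pow_ne_zero 3 hx)).congr_deriv ?_
  simp only [Pi.pow_apply]
  field_simp
  norm_num
  linear_combination (3 * Real.cos x ^ 2) * Real.sin_sq_add_cos_sq x

theorem hasDerivAt_tanh_sq (x : ℝ) :
    HasDerivAt (fun x => Real.tanh x ^ 2) (2 * (Real.sinh x / Real.cosh x ^ 3)) x := by
  have hx := (Real.cosh_pos x).ne'
  have := ((Real.hasDerivAt_sinh x).div (Real.hasDerivAt_cosh x) hx).pow 2
  simp only [Real.tanh_eq_sinh_div_cosh]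
  refine this.congr_deriv ?_
  simp only [Pi.div_apply, Nat.cast_ofNat, Nat.add_one_sub_one, pow_one]
  field_simp
  linear_combination Real.sinh x * Real.cosh_sq x

theorem hasDerivAt_sinh_div_cosh_cube (x : ℝ) :
    HasDerivAt (fun x => Real.sinh x / Real.cosh x ^ 3)
      ((3 - 2 * Real.cosh x ^ 2) / (Real.cosh x ^ 2) ^ 2) x := by
  have hx := (Real.cosh_pos x).ne'
  refine ((Real.hasDerivAt_sinh x).div ((Real.hasDerivAt_cosh x).pow 3)
    (pow_ne_zero 3 hx)).congr_deriv ?_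
  simp only [Pi.pow_apply]
  field_simp
  norm_num
  linear_combination (3 * Real.cosh x ^ 2) * Real.cosh_sq x

theorem hasDerivAt_hypCoth_sq {x : ℝ} (hx : Real.sinh x ≠ 0) :
    HasDerivAt (fun x => hypCoth x ^ 2) (-2 * (Real.cosh x / Real.sinh x ^ 3)) x := by
  have := ((Real.hasDerivAt_cosh x).div (Real.hasDerivAt_sinh x) hx).pow 2
  unfold hypCoth
  refine this.congr_deriv ?_
  simp only [Pi.div_apply, Nat.cast_ofNat, Nat.add_one_sub_one, pow_one]
  field_simp
  linear_combination (-1) * Real.cosh_sq x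

theorem hasDerivAt_cosh_div_sinh_cube {x : ℝ} (hx : Real.sinh x ≠ 0) :
    HasDerivAt (fun x => Real.cosh x / Real.sinh x ^ 3)
      (-(3 + 2 * Real.sinh x ^ 2) / (Real.sinh x ^ 2) ^ 2) x := by
  refine ((Real.hasDerivAt_cosh x).div ((Real.hasDerivAt_sinh x).pow 3)
    (pow_ne_zero 3 hx)).congr_deriv ?_
  simp only [Pi.pow_apply]
  field_simp
  norm_num
  linear_combination (-3 * Real.sinh x ^ 2) * Real.cosh_sq x

/-! ### Solutions of the profile equation, by the roots of the cubic -/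

/-- The case of one real root `α` and two non-real roots `m ± n i`. -/
theorem IsProfileOn.exists_cot_sq {C₁ C₂ : ℝ} {I : Set ℝ} {f f₁ : ℝ → ℝ}
    (h : IsProfileOn C₁ C₂ I f f₁) {α m n β : ℝ} (hn : n ≠ 0)
    (hP : ∀ t : ℝ, cubicP C₁ C₂ t = (t - α) * ((t - m) ^ 2 + n ^ 2))
    (hβ : β = √((m - α) ^ 2 + n ^ 2)) :
    ∃ C, ∀ t ∈ I,
      Real.sin (1 / 2 * jacobiAm (√(6 * β) / 3 * t + √β * C) √((β - m + α) / (2 * β))) ≠ 0 ∧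
      f t = α - β * Real.cot
        (1 / 2 * jacobiAm (√(6 * β) / 3 * t + √β * C) √((β - m + α) / (2 * β))) ^ 2 := by
  have hn2 : 0 < n ^ 2 := by positivity
  have hβ0 : 0 < β := hβ ▸ Real.sqrt_pos.2 (by positivity)
  have hβ2 : β ^ 2 = (m - α) ^ 2 + n ^ 2 := by rw [hβ]; exact Real.sq_sqrt (by positivity)
  have hlt : m - α < β := lt_of_pow_lt_pow_left₀ 2 hβ0.le (by linarith)
  have hgt : α - m < β := lt_of_pow_lt_pow_left₀ 2 hβ0.le (by nlinarith)
  set k := √((β - m + α) / (2 * β)) with hk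
  have hk2 : k ^ 2 = (β - m + α) / (2 * β) :=
    Real.sq_sqrt (div_nonneg (by linarith) (by linarith))
  have hk0 : 0 ≤ k := Real.sqrt_nonneg _
  have hk1 : k < 1 := by
    rw [hk, Real.sqrt_lt' one_pos, div_lt_iff₀ (by positivity)]
    linarith
  -- Comparing coefficients in the two forms of the cubic.
  have e0 := hP 0
  have e1 := hP 1
  have e2 := hP (-1)
  simp only [cubicP] at e0 e1 e2
  have hα : α = -6 - 2 * m := by linarith
  have hC₁ : C₁ = (β ^ 2 - 12 * m ^ 2 - 48 * m - 36) / 6 := by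
    rw [hβ2]
    subst hα
    linarith
  obtain ⟨t₀, ht₀⟩ := h.nonempty
  have hfα : f t₀ ≤ α := by
    have := h.cubicP_nonpos ht₀
    rw [hP] at this
    have hpos : 0 < (f t₀ - m) ^ 2 + n ^ 2 := by positivity
    linarith [nonpos_of_mul_nonpos_left this hpos]
  have hω : √(6 * β) ^ 2 = 6 * β := Real.sq_sqrt (by positivity)
  -- The phase is half the amplitude, so its speed is half that of the amplitude, at twice the phase.
  refine h.exists_phase
    (φ := fun C t => 1 / 2 * jacobiAm (√(6 * β) / 3 * t + √β * C) k)
    (W := fun x => √(6 * β) / 6 * √(1 - k ^ 2 * Real.sin (2 * x) ^ 2))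
    (G := fun x => α - β * Real.cot x ^ 2)
    (G₁ := fun x => 2 * β * (Real.cos x / Real.sin x ^ 3))
    (G₂ := fun x => 2 * β * (-(3 - 2 * Real.sin x ^ 2) / (Real.sin x ^ 2) ^ 2))
    (N := fun x => α * Real.sin x ^ 2 - β * Real.cos x ^ 2) (D := fun x => Real.sin x ^ 2)
    (fun C t => ?_) (fun t x => ?_) (fun x => hasDerivAt_jacobiAm_speed hk0 hk1 _ 2 x)
    (fun x => by simp) (by fun_prop) (by fun_prop) (fun x hx => ?_) (fun x hx => ?_)
    (fun x hx => ?_) (fun x hx => ?_) (fun x hx => by simpa using hx)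
    (fun x => by simp [Real.cot_eq_cos_div_sin, div_neg]) (fun x => ?_) (fun x hx => ?_) (fun x hx => ?_)
    ht₀ ?_ |>.imp fun C hC t ht => ⟨(pow_ne_zero_iff two_ne_zero).1 (hC t ht).1, (hC t ht).2⟩
  · refine ((hasDerivAt_jacobiAm_affine hk0 hk1 (√(6 * β) / 3) (√β * C) t).const_mul
      (1 / 2)).congr_deriv ?_
    rw [← mul_assoc 2]
    norm_num
    ring
  · obtain ⟨C, hC⟩ := exists_jacobiAm_eq hk0 hk1 (Real.sqrt_pos.2 hβ0).ne' (√(6 * β) / 3) t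
      (2 * x)
    exact ⟨C, by simp only [hC]; ring⟩
  · have := Real.sin_sq_add_cos_sq x
    have hc : Real.cos x ^ 2 = 1 := by linarith
    simp only [hx, hc]
    linarith
  · have hs : Real.sin x ≠ 0 := fun h0 => hx (by simp [h0])
    simp only [Real.cot_eq_cos_div_sin]
    field_simp
  · have hs : Real.sin x ≠ 0 := fun h0 => hx (by simp [h0])
    exact (((hasDerivAt_cot_sq hs).const_mul β).const_sub α).congr_deriv (by ring)
  · have hs : Real.sin x ≠ 0 := fun h0 => hx (by simp [h0])
    exact (hasDerivAt_cos_div_sin_cube hs).const_mul _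
  · simp only [Real.cos_neg, Real.sin_neg]
    rw [Odd.neg_pow (by decide), div_neg, mul_neg]
  · have hs : Real.sin x ≠ 0 := fun h0 => hx (by simp [h0])
    simp only [jacobiAm_speed_sq hk0 hk1, jacobiAm_speed_mul_deriv hk0 hk1]
    simp only [div_pow, hω, hk2, Real.cot_eq_cos_div_sin, Real.sin_two_mul, Real.cos_two_mul']
    subst hα hC₁
    field_simp
    have hc : Real.cos x ^ 2 = 1 - Real.sin x ^ 2 := Real.cos_sq' x
    have hc4 : Real.cos x ^ 4 = (1 - Real.sin x ^ 2) ^ 2 := by rw [← hc]; ring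
    ring_nf
    simp only [hc, hc4]
    ring
  · have hs : Real.sin x ≠ 0 := fun h0 => hx (by simp [h0])
    simp only [jacobiAm_speed_sq hk0 hk1]
    simp only [mul_pow, div_pow, hω, hP, hk2,
      Real.cot_eq_cos_div_sin, Real.sin_two_mul, Real.cos_sq']
    have hn' : n ^ 2 = β ^ 2 - (m - α) ^ 2 := by linarith
    rw [hn']
    subst hα
    field_simp
    ring
  · refine ⟨Real.pi / 2 - Real.arctan √((α - f t₀) / β), ?_, ?_⟩
    · rw [Real.sin_pi_div_two_sub]
      exact pow_ne_zero 2 (Real.cos_arctan_pos _).ne'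
    · simp only [Real.cot_eq_cos_div_sin, Real.sin_pi_div_two_sub, Real.cos_pi_div_two_sub]
      rw [← Real.tan_eq_sin_div_cos, Real.tan_arctan,
        Real.sq_sqrt (div_nonneg (by linarith) hβ0.le)]
      field_simp
      ring

/-- Three real roots `a < b < c`: a solution with a value at most `a` blows up like `tan²`. -/
theorem IsProfileOn.exists_tan_sq_jacobiAm {C₁ C₂ : ℝ} {I : Set ℝ} {f f₁ : ℝ → ℝ}
    (h : IsProfileOn C₁ C₂ I f f₁) {a b c : ℝ} (hab : a < b) (hbc : b < c)
    (hP : ∀ t : ℝ, cubicP C₁ C₂ t = (t - a) * (t - b) * (t - c))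
    {t₀ : ℝ} (ht₀ : t₀ ∈ I) (hfa : f t₀ ≤ a) :
    ∃ C, ∀ t ∈ I,
      Real.cos (jacobiAm (√((c - a) / 6) * t + √(c - a) * C) √((c - b) / (c - a))) ≠ 0 ∧
      f t = a - (b - a) * Real.tan
        (jacobiAm (√((c - a) / 6) * t + √(c - a) * C) √((c - b) / (c - a))) ^ 2 := by
  have hac : 0 < c - a := by linarith
  have hba : 0 < b - a := by linarith
  set k := √((c - b) / (c - a)) with hk
  have hk2 : k ^ 2 = (c - b) / (c - a) := Real.sq_sqrt (div_nonneg (by linarith) hac.le)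
  have hk0 : 0 ≤ k := Real.sqrt_nonneg _
  have hk1 : k < 1 := by
    rw [hk, Real.sqrt_lt' one_pos, div_lt_iff₀ hac]
    linarith
  -- Comparing coefficients in the two forms of the cubic.
  have e0 := hP 0
  have e1 := hP 1
  have e2 := hP (-1)
  simp only [cubicP] at e0 e1 e2
  have ha : a = -6 - b - c := by linarith
  have hC₁ : C₁ = (a * b + b * c + c * a) / 6 := by linarith
  have hω : √((c - a) / 6) ^ 2 = (c - a) / 6 := Real.sq_sqrt (by positivity)
  refine h.exists_phase
    (φ := fun C t => jacobiAm (√((c - a) / 6) * t + √(c - a) * C) k)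
    (W := fun x => √((c - a) / 6) * √(1 - k ^ 2 * Real.sin (1 * x) ^ 2))
    (G := fun x => a - (b - a) * Real.tan x ^ 2)
    (G₁ := fun x => -2 * (b - a) * (Real.sin x / Real.cos x ^ 3))
    (G₂ := fun x => -2 * (b - a) * ((3 - 2 * Real.cos x ^ 2) / (Real.cos x ^ 2) ^ 2))
    (N := fun x => a * Real.cos x ^ 2 - (b - a) * Real.sin x ^ 2) (D := fun x => Real.cos x ^ 2)
    (fun C t => ?_) (fun t x => exists_jacobiAm_eq hk0 hk1 (Real.sqrt_pos.2 hac).ne' _ t x)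
    (fun x => hasDerivAt_jacobiAm_speed hk0 hk1 _ 1 x)
    (fun x => by simp) (by fun_prop) (by fun_prop) (fun x hx => ?_) (fun x hx => ?_)
    (fun x hx => ?_) (fun x hx => ?_) (fun x hx => by simpa using hx)
    (fun x => by simp) (fun x => ?_) (fun x hx => ?_) (fun x hx => ?_)
    ht₀ ?_ |>.imp fun C hC t ht => ⟨(pow_ne_zero_iff two_ne_zero).1 (hC t ht).1, (hC t ht).2⟩
  · rw [one_mul]
    exact hasDerivAt_jacobiAm_affine hk0 hk1 _ _ t
  · have hs : Real.sin x ^ 2 = 1 := by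
      have := Real.sin_sq_add_cos_sq x
      linarith
    simp only [hx, hs]
    linarith
  · have hs : Real.cos x ≠ 0 := fun h0 => hx (by simp [h0])
    simp only [Real.tan_eq_sin_div_cos]
    field_simp
  · have hs : Real.cos x ≠ 0 := fun h0 => hx (by simp [h0])
    exact (((hasDerivAt_tan_sq hs).const_mul (b - a)).const_sub a).congr_deriv (by ring)
  · have hs : Real.cos x ≠ 0 := fun h0 => hx (by simp [h0])
    exact (hasDerivAt_sin_div_cos_cube hs).const_mul _
  · simp only [Real.cos_neg, Real.sin_neg]
    ring
  · have hs : Real.cos x ≠ 0 := fun h0 => hx (by simp [h0])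
    simp only [jacobiAm_speed_sq hk0 hk1, jacobiAm_speed_mul_deriv hk0 hk1]
    simp only [hω, hk2, Real.tan_eq_sin_div_cos, one_mul]
    subst ha hC₁
    field_simp
    have hc : Real.sin x ^ 2 = 1 - Real.cos x ^ 2 := Real.sin_sq x
    have hc4 : Real.sin x ^ 4 = (1 - Real.cos x ^ 2) ^ 2 := by rw [← hc]; ring
    ring_nf
    simp only [hc, hc4]
    ring
  · have hs : Real.cos x ≠ 0 := fun h0 => hx (by simp [h0])
    simp only [jacobiAm_speed_sq hk0 hk1]
    simp only [mul_pow, div_pow, hω, hP, hk2, Real.tan_eq_sin_div_cos, one_mul, Real.sin_sq]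
    field_simp
    ring
  · refine ⟨Real.arctan √((a - f t₀) / (b - a)), pow_ne_zero 2 (Real.cos_arctan_pos _).ne', ?_⟩
    simp only [Real.tan_arctan]
    rw [Real.sq_sqrt (div_nonneg (by linarith) hba.le)]
    field_simp
    ring

/-- Three real roots `a < b < c`: a solution with a value in `[b, c]` oscillates there. -/
theorem IsProfileOn.exists_sin_sq_jacobiAm {C₁ C₂ : ℝ} {I : Set ℝ} {f f₁ : ℝ → ℝ}
    (h : IsProfileOn C₁ C₂ I f f₁) {a b c : ℝ} (hab : a < b) (hbc : b < c)
    (hP : ∀ t : ℝ, cubicP C₁ C₂ t = (t - a) * (t - b) * (t - c))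
    {t₀ : ℝ} (ht₀ : t₀ ∈ I) (hfb : b ≤ f t₀) (hfc : f t₀ ≤ c) :
    ∃ C, ∀ t ∈ I, f t = c - (c - b) * Real.sin
        (jacobiAm (√((c - a) / 6) * t + √(c - a) * C) √((c - b) / (c - a))) ^ 2 := by
  have hac : 0 < c - a := by linarith
  have hcb : 0 < c - b := by linarith
  set k := √((c - b) / (c - a)) with hk
  have hk2 : k ^ 2 = (c - b) / (c - a) := Real.sq_sqrt (div_nonneg (by linarith) hac.le)
  have hk0 : 0 ≤ k := Real.sqrt_nonneg _
  have hk1 : k < 1 := by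
    rw [hk, Real.sqrt_lt' one_pos, div_lt_iff₀ hac]
    linarith
  -- Comparing coefficients in the two forms of the cubic.
  have e0 := hP 0
  have e1 := hP 1
  have e2 := hP (-1)
  simp only [cubicP] at e0 e1 e2
  have ha : a = -6 - b - c := by linarith
  have hC₁ : C₁ = (a * b + b * c + c * a) / 6 := by linarith
  have hω : √((c - a) / 6) ^ 2 = (c - a) / 6 := Real.sq_sqrt (by positivity)
  refine h.exists_phase
    (φ := fun C t => jacobiAm (√((c - a) / 6) * t + √(c - a) * C) k)
    (W := fun x => √((c - a) / 6) * √(1 - k ^ 2 * Real.sin (1 * x) ^ 2))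
    (G := fun x => c - (c - b) * Real.sin x ^ 2)
    (G₁ := fun x => -2 * (c - b) * (Real.sin x * Real.cos x))
    (G₂ := fun x => -2 * (c - b) * (1 - 2 * Real.sin x ^ 2))
    (N := fun x => c - (c - b) * Real.sin x ^ 2) (D := fun x => 1)
    (fun C t => ?_) (fun t x => exists_jacobiAm_eq hk0 hk1 (Real.sqrt_pos.2 hac).ne' _ t x)
    (fun x => hasDerivAt_jacobiAm_speed hk0 hk1 _ 1 x)
    (fun x => by simp) (by fun_prop) (by fun_prop) (fun x hx => absurd hx one_ne_zero)
    (fun x hx => mul_one _)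
    (fun x hx => ?_) (fun x hx => ?_) (fun x hx => hx)
    (fun x => by simp) (fun x => ?_) (fun x hx => ?_) (fun x hx => ?_)
    ht₀ ?_ |>.imp fun C hC t ht => (hC t ht).2
  · rw [one_mul]
    exact hasDerivAt_jacobiAm_affine hk0 hk1 _ _ t
  · refine ((((Real.hasDerivAt_sin x).pow 2).const_mul (c - b)).const_sub c).congr_deriv ?_
    norm_num
    ring
  · refine (((Real.hasDerivAt_sin x).mul (Real.hasDerivAt_cos x)).const_mul
      (-2 * (c - b))).congr_deriv ?_
    linear_combination (-2 * (c - b)) * Real.sin_sq_add_cos_sq x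
  · simp only [Real.cos_neg, Real.sin_neg]
    ring
  · simp only [jacobiAm_speed_sq hk0 hk1, jacobiAm_speed_mul_deriv hk0 hk1]
    simp only [hω, hk2, one_mul]
    subst ha hC₁
    field_simp
    have hc : Real.cos x ^ 2 = 1 - Real.sin x ^ 2 := Real.cos_sq' x
    ring_nf
    simp only [hc]
    ring
  · simp only [jacobiAm_speed_sq hk0 hk1]
    simp only [mul_pow, hω, hP, hk2, one_mul, Real.cos_sq']
    field_simp
    ring
  · have h0 : 0 ≤ (c - f t₀) / (c - b) := div_nonneg (by linarith) hcb.le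
    refine ⟨Real.arcsin √((c - f t₀) / (c - b)), one_ne_zero, ?_⟩
    have h1 : √((c - f t₀) / (c - b)) ≤ 1 := by
      rw [Real.sqrt_le_one, div_le_one hcb]
      linarith
    simp only [Real.sin_arcsin (by linarith [Real.sqrt_nonneg ((c - f t₀) / (c - b))]) h1,
      Real.sq_sqrt h0]
    field_simp
    ring

theorem hasDerivAt_affine_phase (w σ C t : ℝ) : HasDerivAt (fun t => σ * (w * t + C)) (σ * w) t :=
  ((((hasDerivAt_id t).const_mul w).add_const C).const_mul σ).congr_deriv (by ring)

theorem exists_affine_phase_eq (w : ℝ) {σ : ℝ} (hσ : σ ≠ 0) (t x : ℝ) :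
    ∃ C, σ * (w * t + C) = x :=
  ⟨x / σ - w * t, by field_simp; ring⟩

/-- The triple root `-2`, away from which a solution is a rational function. -/
theorem IsProfileOn.exists_inv_sq {I : Set ℝ} {f f₁ : ℝ → ℝ} (h : IsProfileOn 2 8 I f f₁)
    {t₀ : ℝ} (ht₀ : t₀ ∈ I) (hf₀ : f t₀ ≠ -2) :
    ∃ C, ∀ t ∈ I, t + C ≠ 0 ∧ f t = -2 - 6 / (t + C) ^ 2 := by
  have hlt : f t₀ < -2 := by
    refine lt_of_le_of_ne ?_ hf₀
    by_contra! hgt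
    have := h.cubicP_nonpos ht₀
    have h3 : 0 < (f t₀ + 2) ^ 3 := pow_pos (by linarith) 3
    simp only [cubicP] at this
    linarith
  refine h.exists_phase (φ := fun C t => 1 * (1 * t + C)) (W := fun _ => 1 * 1) (W₁ := fun _ => 0)
    (G := fun x => -2 - 6 / x ^ 2) (G₁ := fun x => 12 / x ^ 3) (G₂ := fun x => -36 / x ^ 4)
    (N := fun x => -2 * x ^ 2 - 6) (D := fun x => x ^ 2)
    (fun C t => hasDerivAt_affine_phase 1 1 C t)
    (fun t x => exists_affine_phase_eq 1 one_ne_zero t x)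
    (fun x => hasDerivAt_const x _) (fun x => rfl) (by fun_prop) (by fun_prop)
    (fun x hx => ?_) (fun x hx => ?_) (fun x hx => ?_) (fun x hx => ?_)
    (fun x hx => by simpa using hx) (fun x => by simp) (fun x => ?_) (fun x hx => ?_)
    (fun x hx => ?_) ht₀ ?_ |>.imp fun C hC t ht => by
      simpa only [one_mul, ne_eq, pow_eq_zero_iff two_ne_zero] using hC t ht
  · simp only [hx]
    norm_num
  · have hx' : x ≠ 0 := fun h0 => hx (by simp [h0])
    field_simp
  · have hx' : x ≠ 0 := fun h0 => hx (by simp [h0])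
    refine (((hasDerivAt_const x (6 : ℝ)).div (hasDerivAt_pow 2 x) hx).const_sub (-2)).congr_deriv ?_
    norm_num
    field_simp
    norm_num
  · have hx' : x ≠ 0 := fun h0 => hx (by simp [h0])
    refine ((hasDerivAt_const x (12 : ℝ)).div (hasDerivAt_pow 3 x)
      (pow_ne_zero 3 hx')).congr_deriv ?_
    norm_num
    field_simp
    norm_num
  · simp only [Odd.neg_pow (show Odd 3 by decide), div_neg]
  · have hx' : x ≠ 0 := fun h0 => hx (by simp [h0])
    field_simp
    ring
  · have hx' : x ≠ 0 := fun h0 => hx (by simp [h0])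
    simp only [cubicP]
    field_simp
    ring
  · have hpos : 0 < 6 / (-2 - f t₀) := div_pos (by norm_num) (by linarith)
    refine ⟨√(6 / (-2 - f t₀)), by simpa using (Real.sqrt_pos.2 hpos).ne', ?_⟩
    simp only [Real.sq_sqrt hpos.le]
    have : -2 - f t₀ ≠ 0 := by linarith
    field_simp
    ring

/-- A simple root `-2 - 2s` below the double root `-2 + s`. -/
theorem IsProfileOn.exists_tan_sq {C₁ C₂ : ℝ} {I : Set ℝ} {f f₁ : ℝ → ℝ}
    (h : IsProfileOn C₁ C₂ I f f₁) {s w : ℝ} (hs : 0 < s) (hw : w ^ 2 = s / 2)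
    (hP : ∀ t : ℝ, cubicP C₁ C₂ t = (t + 2 - s) ^ 2 * (t + 2 + 2 * s))
    {t₀ : ℝ} (ht₀ : t₀ ∈ I) (hf₀ : f t₀ ≠ -2 + s) :
    ∃ C, ∀ t ∈ I, Real.cos (w * t + C) ≠ 0 ∧
      f t = -2 - 2 * s - 3 * s * Real.tan (w * t + C) ^ 2 := by
  have hle : f t₀ ≤ -2 - 2 * s := by
    have := h.cubicP_nonpos ht₀
    rw [hP] at this
    have hpos : 0 < (f t₀ + 2 - s) ^ 2 := by
      have : f t₀ + 2 - s ≠ 0 := fun h0 => hf₀ (by linarith)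
      positivity
    linarith [nonpos_of_mul_nonpos_right this hpos]
  have e0 := hP 0
  have e1 := hP 1
  simp only [cubicP] at e0 e1
  have hC₁ : C₁ = 2 - s ^ 2 / 2 := by linarith
  refine h.exists_phase (φ := fun C t => 1 * (w * t + C)) (W := fun _ => 1 * w) (W₁ := fun _ => 0)
    (G := fun x => -2 - 2 * s - 3 * s * Real.tan x ^ 2)
    (G₁ := fun x => -6 * s * (Real.sin x / Real.cos x ^ 3))
    (G₂ := fun x => -6 * s * ((3 - 2 * Real.cos x ^ 2) / (Real.cos x ^ 2) ^ 2))
    (N := fun x => (-2 - 2 * s) * Real.cos x ^ 2 - 3 * s * Real.sin x ^ 2)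
    (D := fun x => Real.cos x ^ 2)
    (fun C t => hasDerivAt_affine_phase w 1 C t)
    (fun t x => exists_affine_phase_eq w one_ne_zero t x)
    (fun x => hasDerivAt_const x _) (fun x => rfl) (by fun_prop) (by fun_prop)
    (fun x hx => ?_) (fun x hx => ?_) (fun x hx => ?_) (fun x hx => ?_)
    (fun x hx => by simpa using hx) (fun x => by simp) (fun x => ?_) (fun x hx => ?_)
    (fun x hx => ?_) ht₀ ?_ |>.imp fun C hC t ht => by
      simpa only [one_mul, ne_eq, pow_eq_zero_iff two_ne_zero] using hC t ht
  · have hs : Real.sin x ^ 2 = 1 := by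
      have := Real.sin_sq_add_cos_sq x
      linarith
    simp only [hx, hs]
    linarith
  · have hs : Real.cos x ≠ 0 := fun h0 => hx (by simp [h0])
    simp only [Real.tan_eq_sin_div_cos]
    field_simp
  · have hs : Real.cos x ≠ 0 := fun h0 => hx (by simp [h0])
    exact (((hasDerivAt_tan_sq hs).const_mul (3 * s)).const_sub _).congr_deriv (by ring)
  · have hs : Real.cos x ≠ 0 := fun h0 => hx (by simp [h0])
    exact (hasDerivAt_sin_div_cos_cube hs).const_mul _
  · simp only [Real.cos_neg, Real.sin_neg]
    ring
  · have hs : Real.cos x ≠ 0 := fun h0 => hx (by simp [h0])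
    simp only [one_mul, hw, hC₁, mul_zero, add_zero, Real.tan_eq_sin_div_cos, div_pow, Real.sin_sq]
    field_simp
    ring
  · have hs : Real.cos x ≠ 0 := fun h0 => hx (by simp [h0])
    simp only [one_mul, hw, hP, mul_pow, div_pow, Real.tan_eq_sin_div_cos, Real.sin_sq]
    field_simp
    ring
  · refine ⟨Real.arctan √((-2 - 2 * s - f t₀) / (3 * s)),
      pow_ne_zero 2 (Real.cos_arctan_pos _).ne', ?_⟩
    simp only [Real.tan_arctan]
    rw [Real.sq_sqrt (div_nonneg (by linarith) (by linarith))]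
    field_simp
    ring

/-- A simple root `-2 + 2s` above the double root `-2 - s`: solutions with a value between them. -/
theorem IsProfileOn.exists_tanh_sq {C₁ C₂ : ℝ} {I : Set ℝ} {f f₁ : ℝ → ℝ}
    (h : IsProfileOn C₁ C₂ I f f₁) {s w σ : ℝ} (hs : 0 < s) (hσ : σ ≠ 0)
    (hw : (σ * w) ^ 2 = s / 2)
    (hP : ∀ t : ℝ, cubicP C₁ C₂ t = (t + 2 + s) ^ 2 * (t + 2 - 2 * s))
    {t₀ : ℝ} (ht₀ : t₀ ∈ I) (hgt : -2 - s < f t₀) :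
    ∃ C, ∀ t ∈ I, f t = -2 + 2 * s - 3 * s * Real.tanh (σ * (w * t + C)) ^ 2 := by
  have hle : f t₀ ≤ -2 + 2 * s := by
    have := h.cubicP_nonpos ht₀
    rw [hP] at this
    have hpos : 0 < (f t₀ + 2 + s) ^ 2 := pow_pos (by linarith) 2
    linarith [nonpos_of_mul_nonpos_right this hpos]
  have e0 := hP 0
  have e1 := hP 1
  simp only [cubicP] at e0 e1
  have hC₁ : C₁ = 2 - s ^ 2 / 2 := by linarith
  refine h.exists_phase (φ := fun C t => σ * (w * t + C)) (W := fun _ => σ * w) (W₁ := fun _ => 0)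
    (G := fun x => -2 + 2 * s - 3 * s * Real.tanh x ^ 2)
    (G₁ := fun x => -6 * s * (Real.sinh x / Real.cosh x ^ 3))
    (G₂ := fun x => -6 * s * ((3 - 2 * Real.cosh x ^ 2) / (Real.cosh x ^ 2) ^ 2))
    (N := fun x => (-2 + 2 * s) * Real.cosh x ^ 2 - 3 * s * Real.sinh x ^ 2)
    (D := fun x => Real.cosh x ^ 2)
    (fun C t => hasDerivAt_affine_phase w σ C t)
    (fun t x => exists_affine_phase_eq w hσ t x)
    (fun x => hasDerivAt_const x _) (fun x => rfl) (by fun_prop) (by fun_prop)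
    (fun x hx => absurd hx (pow_ne_zero 2 (Real.cosh_pos x).ne')) (fun x hx => ?_) (fun x hx => ?_)
    (fun x hx => (hasDerivAt_sinh_div_cosh_cube x).const_mul _)
    (fun x hx => by simpa using hx) (fun x => by simp) (fun x => ?_) (fun x hx => ?_)
    (fun x hx => ?_) ht₀ ?_ |>.imp fun C hC t ht => (hC t ht).2
  · have hc := (Real.cosh_pos x).ne'
    simp only [Real.tanh_eq_sinh_div_cosh]
    field_simp
  · exact (((hasDerivAt_tanh_sq x).const_mul (3 * s)).const_sub _).congr_deriv (by ring)
  · simp only [Real.cosh_neg, Real.sinh_neg]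
    ring
  · have hc := (Real.cosh_pos x).ne'
    simp only [hw, hC₁, mul_zero, add_zero, Real.tanh_eq_sinh_div_cosh, div_pow, Real.sinh_sq]
    field_simp
    ring
  · have hc := (Real.cosh_pos x).ne'
    simp only [hw, hP, mul_pow _ (_ / _), mul_pow _ s, div_pow, Real.tanh_eq_sinh_div_cosh,
      Real.sinh_sq]
    field_simp
    ring
  · -- The equation for `sinh² x = y` with `tanh² x = y / (1 + y)`.
    have hd : 0 < f t₀ + 2 + s := by linarith
    have hy : 0 ≤ (-2 + 2 * s - f t₀) / (f t₀ + 2 + s) := div_nonneg (by linarith) hd.le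
    refine ⟨Real.arsinh √((-2 + 2 * s - f t₀) / (f t₀ + 2 + s)),
      pow_ne_zero 2 (Real.cosh_pos _).ne', ?_⟩
    simp only [Real.tanh_eq_sinh_div_cosh, div_pow, Real.cosh_sq, Real.sinh_arsinh]
    rw [Real.sq_sqrt hy]
    have : (-2 + 2 * s - f t₀) / (f t₀ + 2 + s) + 1 = 3 * s / (f t₀ + 2 + s) := by
      field_simp
      ring
    rw [this]
    field_simp
    ring

/-- A simple root `-2 + 2s` above the double root `-2 - s`: solutions with a value below both. -/
theorem IsProfileOn.exists_hypCoth_sq {C₁ C₂ : ℝ} {I : Set ℝ} {f f₁ : ℝ → ℝ}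
    (h : IsProfileOn C₁ C₂ I f f₁) {s w σ : ℝ} (hs : 0 < s) (hσ : σ ≠ 0)
    (hw : (σ * w) ^ 2 = s / 2)
    (hP : ∀ t : ℝ, cubicP C₁ C₂ t = (t + 2 + s) ^ 2 * (t + 2 - 2 * s))
    {t₀ : ℝ} (ht₀ : t₀ ∈ I) (hlt : f t₀ < -2 - s) :
    ∃ C, ∀ t ∈ I, σ * (w * t + C) ≠ 0 ∧
      f t = -2 + 2 * s - 3 * s * hypCoth (σ * (w * t + C)) ^ 2 := by
  have e0 := hP 0
  have e1 := hP 1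
  simp only [cubicP] at e0 e1
  have hC₁ : C₁ = 2 - s ^ 2 / 2 := by linarith
  refine h.exists_phase (φ := fun C t => σ * (w * t + C)) (W := fun _ => σ * w) (W₁ := fun _ => 0)
    (G := fun x => -2 + 2 * s - 3 * s * hypCoth x ^ 2)
    (G₁ := fun x => 6 * s * (Real.cosh x / Real.sinh x ^ 3))
    (G₂ := fun x => 6 * s * (-(3 + 2 * Real.sinh x ^ 2) / (Real.sinh x ^ 2) ^ 2))
    (N := fun x => (-2 + 2 * s) * Real.sinh x ^ 2 - 3 * s * Real.cosh x ^ 2)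
    (D := fun x => Real.sinh x ^ 2)
    (fun C t => hasDerivAt_affine_phase w σ C t)
    (fun t x => exists_affine_phase_eq w hσ t x)
    (fun x => hasDerivAt_const x _) (fun x => rfl) (by fun_prop) (by fun_prop)
    (fun x hx => ?_) (fun x hx => ?_) (fun x hx => ?_) (fun x hx => ?_)
    (fun x hx => by simpa using hx) (fun x => by simp [hypCoth, div_neg]) (fun x => ?_)
    (fun x hx => ?_) (fun x hx => ?_) ht₀ ?_ |>.imp fun C hC t ht =>
      ⟨fun h0 => (hC t ht).1 (by simp [h0]), (hC t ht).2⟩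
  · simp only [Real.cosh_sq, hx]
    linarith
  · have hs : Real.sinh x ≠ 0 := fun h0 => hx (by simp [h0])
    simp only [hypCoth]
    field_simp
  · have hs : Real.sinh x ≠ 0 := fun h0 => hx (by simp [h0])
    exact (((hasDerivAt_hypCoth_sq hs).const_mul (3 * s)).const_sub _).congr_deriv (by ring)
  · have hs : Real.sinh x ≠ 0 := fun h0 => hx (by simp [h0])
    exact (hasDerivAt_cosh_div_sinh_cube hs).const_mul _
  · simp only [Real.cosh_neg, Real.sinh_neg]
    rw [Odd.neg_pow (by decide), div_neg, mul_neg]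
  · have hs : Real.sinh x ≠ 0 := fun h0 => hx (by simp [h0])
    simp only [hw, hC₁, mul_zero, add_zero, hypCoth, div_pow, Real.cosh_sq]
    field_simp
    ring
  · have hs : Real.sinh x ≠ 0 := fun h0 => hx (by simp [h0])
    simp only [hw, hP, mul_pow _ (_ / _), mul_pow _ s, div_pow, hypCoth, Real.cosh_sq]
    field_simp
    ring
  · -- The equation for `sinh² x = y` with `coth² x = 1 + 1 / y`.
    have hd : 0 < -2 - s - f t₀ := by linarith
    have hy : 0 < 3 * s / (-2 - s - f t₀) := by positivity
    refine ⟨Real.arsinh √(3 * s / (-2 - s - f t₀)), ?_, ?_⟩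
    · simp only [Real.sinh_arsinh]
      exact pow_ne_zero 2 (Real.sqrt_pos.2 hy).ne'
    · simp only [hypCoth, div_pow, Real.cosh_sq, Real.sinh_arsinh]
      rw [Real.sq_sqrt hy.le]
      field_simp
      ring

/-! ### Classification of the solutions of the profile equation -/

theorem continuous_cubicP (C₁ C₂ : ℝ) : Continuous (cubicP C₁ C₂) := by
  unfold cubicP
  fun_prop

theorem exists_cubicP_eq_zero (C₁ C₂ : ℝ) : ∃ α, cubicP C₁ C₂ α = 0 := by
  set A := 8 + 6 * |C₁| + |C₂| with hA
  have h1 := abs_nonneg C₁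
  have h2 := abs_nonneg C₂
  have hA1 : 1 ≤ A := by linarith
  have hA2 : 1 ≤ A ^ 2 := one_le_pow₀ hA1
  have hA3 : A ≤ A ^ 2 := by nlinarith
  have key : 6 * A ^ 2 + 6 * |C₁| * A + |C₂| ≤ A ^ 3 := by
    have e : A ^ 3 = 6 * A ^ 2 + (2 * A ^ 2 + 6 * |C₁| * A ^ 2 + |C₂| * A ^ 2) := by
      rw [show A ^ 3 = A * A ^ 2 by ring]
      nth_rewrite 1 [hA]
      ring
    rw [e]
    nlinarith [mul_le_mul_of_nonneg_left hA3 h1, mul_le_mul_of_nonneg_left hA2 h2]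
  have hC1 := mul_le_mul_of_nonneg_right (neg_abs_le C₁) (by linarith : 0 ≤ A)
  have := intermediate_value_Icc (show -A ≤ A by linarith) (continuous_cubicP C₁ C₂).continuousOn
  obtain ⟨α, -, hα⟩ := this (show (0 : ℝ) ∈ Icc _ _ from
    ⟨by unfold cubicP; linarith [le_abs_self C₂],
      by unfold cubicP; linarith [neg_abs_le C₂]⟩)
  exact ⟨α, hα⟩

/-- For `C₁ < 2` the two curves are `C₂ = 12C₁ - 16 ± 2s³`, where `s = √(2(2 - C₁))`. -/
theorem curveLPlus_curveLMinus_eq {C₁ : ℝ} (h : C₁ < 2) :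
    ∃ s : ℝ, 0 < s ∧ √(2 * (2 - C₁)) = s ∧ C₁ = 2 - s ^ 2 / 2 ∧
      curveLPlus C₁ = 8 - 6 * s ^ 2 + 2 * s ^ 3 ∧ curveLMinus C₁ = 8 - 6 * s ^ 2 - 2 * s ^ 3 := by
  have hpos : 0 < 2 * (2 - C₁) := by linarith
  have h2 : √(2 * (2 - C₁)) ^ 2 = 2 * (2 - C₁) := Real.sq_sqrt hpos.le
  unfold curveLPlus curveLMinus
  set s := √(2 * (2 - C₁)) with hs
  have hC : C₁ = 2 - s ^ 2 / 2 := by linarith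
  refine ⟨s, Real.sqrt_pos.2 hpos, rfl, hC, ?_, ?_⟩
  · linear_combination (12 - 4 * s) * hC
  · linear_combination (12 + 4 * s) * hC

/-- In region `I` the cubic has exactly one real root, and it is simple. -/
theorem exists_factor_of_mem_regionI {C₁ C₂ : ℝ} (h : (C₁, C₂) ∈ regionI) :
    ∃ α m n : ℝ, n ≠ 0 ∧ ∀ t : ℝ, cubicP C₁ C₂ t = (t - α) * ((t - m) ^ 2 + n ^ 2) := by
  obtain ⟨α, hα⟩ := exists_cubicP_eq_zero C₁ C₂
  have hC₂ : C₂ = -(α ^ 3 + 6 * α ^ 2 + 6 * C₁ * α) := by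
    unfold cubicP at hα
    linarith
  -- Minus a quarter of the discriminant of the quadratic cofactor `t² + (6 + α) t + …`.
  have hpos : 0 < 3 / 4 * (α + 2) ^ 2 + 6 * C₁ - 12 := by
    rcases h with (h | ⟨h1, h2⟩) | ⟨h1, h2⟩
    · have : 2 < C₁ := h
      nlinarith [sq_nonneg (α + 2)]
    · obtain rfl : C₁ = 2 := h1
      have hne : α + 2 ≠ 0 := fun h0 => h2 (by
        obtain rfl : α = -2 := by linarith
        show C₂ = 8
        rw [hC₂]; norm_num)
      have : 0 < (α + 2) ^ 2 := by positivity
      linarith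
    · obtain ⟨s, hs, -, rfl, hp, hm⟩ := curveLPlus_curveLMinus_eq h1
      simp only [hp, hm, hC₂] at h2
      by_contra! hle
      have habs : |α + 2| ≤ 2 * s := abs_le_of_sq_le_sq (by nlinarith) (by linarith)
      have := abs_le.1 habs
      rcases h2 with h2 | h2
      · have := mul_nonneg (sq_nonneg (α + 2 - s)) (by linarith : 0 ≤ 2 * s + (α + 2))
        nlinarith
      · have := mul_nonneg (sq_nonneg (α + 2 + s)) (by linarith : 0 ≤ 2 * s - (α + 2))
        nlinarith
  refine ⟨α, -(6 + α) / 2, _, (Real.sqrt_pos.2 hpos).ne', fun t => ?_⟩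
  rw [Real.sq_sqrt hpos.le, cubicP, hC₂]
  ring

/-- In region `II` the cubic has three distinct real roots. -/
theorem exists_factor_of_mem_regionII {C₁ C₂ : ℝ} (h : (C₁, C₂) ∈ regionII) :
    ∃ a b c : ℝ, a < b ∧ b < c ∧ ∀ t : ℝ, cubicP C₁ C₂ t = (t - a) * (t - b) * (t - c) := by
  obtain ⟨h1, h2, h3⟩ := h
  obtain ⟨s, hs, -, hC, hp, hm⟩ := curveLPlus_curveLMinus_eq h1
  simp only [hp, hm] at h2 h3
  have hcont := (continuous_cubicP C₁ C₂).continuousOn (s := univ)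
  simp only at h1 hC
  -- The critical points of the cubic are `-2 ± s`.
  have v1 : cubicP C₁ C₂ (-2 - 2 * s) < 0 := by unfold cubicP; rw [hC]; nlinarith
  have v2 : 0 < cubicP C₁ C₂ (-2 - s) := by unfold cubicP; rw [hC]; nlinarith
  have v3 : cubicP C₁ C₂ (-2 + s) < 0 := by unfold cubicP; rw [hC]; nlinarith
  have v4 : 0 < cubicP C₁ C₂ (-2 + 2 * s) := by unfold cubicP; rw [hC]; nlinarith
  obtain ⟨a, ⟨-, ha⟩, ra⟩ := intermediate_value_Ioo (by linarith) (hcont.mono (subset_univ _))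
    (show (0 : ℝ) ∈ Ioo _ _ from ⟨v1, v2⟩)
  obtain ⟨b, ⟨hb, hb'⟩, rb⟩ := intermediate_value_Ioo' (by linarith) (hcont.mono (subset_univ _))
    (show (0 : ℝ) ∈ Ioo _ _ from ⟨v3, v2⟩)
  obtain ⟨c, ⟨hc, -⟩, rc⟩ := intermediate_value_Ioo (by linarith) (hcont.mono (subset_univ _))
    (show (0 : ℝ) ∈ Ioo _ _ from ⟨v3, v4⟩)
  have hab : a < b := ha.trans hb
  have hbc : b < c := hb'.trans hc
  unfold cubicP at ra rb rc
  have e1 : a ^ 2 + a * b + b ^ 2 + 6 * (a + b) + 6 * C₁ = 0 :=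
    mul_left_cancel₀ (sub_ne_zero.2 hab.ne) (by linear_combination ra - rb)
  have e2 : b ^ 2 + b * c + c ^ 2 + 6 * (b + c) + 6 * C₁ = 0 :=
    mul_left_cancel₀ (sub_ne_zero.2 hbc.ne) (by linear_combination rb - rc)
  have e3 : a + b + c + 6 = 0 :=
    mul_left_cancel₀ (sub_ne_zero.2 (hab.trans hbc).ne) (by linear_combination e1 - e2)
  refine ⟨a, b, c, hab, hbc, fun t => ?_⟩
  have hC₁ : C₁ = -(a ^ 2 + a * b + b ^ 2 + 6 * (a + b)) / 6 := by linarith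
  have hC₂ : C₂ = -(a ^ 3 + 6 * a ^ 2 + 6 * C₁ * a) := by linarith
  obtain rfl : c = -6 - a - b := by linarith
  unfold cubicP
  rw [hC₂, hC₁]
  ring

theorem rpow_one_div_four_pow_four {x : ℝ} (hx : 0 ≤ x) : (x ^ (1 / 4 : ℝ)) ^ 4 = x := by
  rw [← Real.rpow_natCast, ← Real.rpow_mul hx]
  norm_num

/-- The parameter plane is the union of the regions of the list. -/
theorem mem_parameter_regions (C₁ C₂ : ℝ) :
    (C₁, C₂) ∈ regionI ∨ (C₁, C₂) ∈ pointP0 ∨ (C₁, C₂) ∈ regionII ∨ (C₁, C₂) ∈ gammaPlus ∨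
      (C₁, C₂) ∈ gammaMinus := by
  simp only [regionI, pointP0, regionII, gammaPlus, gammaMinus, mem_union, mem_ofPred_eq,
    mem_singleton_iff, Prod.mk.injEq]
  rcases lt_trichotomy C₁ 2 with h | h | h
  · rcases lt_trichotomy C₂ (curveLPlus C₁) with h1 | h1 | h1 <;>
      rcases lt_trichotomy C₂ (curveLMinus C₁) with h2 | h2 | h2 <;> tauto
  · tauto
  · tauto

theorem IsProfileOn.isListedProfile {C₁ C₂ : ℝ} {I : Set ℝ} {f f₁ : ℝ → ℝ}
    (h : IsProfileOn C₁ C₂ I f f₁) {Ω : Set (ℝ × ℝ)} {κ : ℝ × ℝ → ℝ}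
    (hκ : ∀ q ∈ Ω, angleOf q ∈ I ∧ κ q = f (angleOf q)) : IsListedProfile Ω C₁ C₂ κ := by
  obtain ⟨t₀, ht₀⟩ := h.nonempty
  have const : ∀ e, cubicP C₁ C₂ e = 0 → e ^ 2 + 4 * e + 2 * C₁ = 0 → f t₀ = e →
      IsListedProfile Ω C₁ C₂ κ := fun e he he' h0 =>
    Or.inl ⟨e, he, by linarith, fun q hq =>
      (hκ q hq).2.trans (h.const_of_equilibrium he he' ht₀ h0 _ (hκ q hq).1)⟩
  rcases mem_parameter_regions C₁ C₂ with hr | hr | hr | hr | hr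
  · obtain ⟨α, m, n, hn, hP⟩ := exists_factor_of_mem_regionI hr
    obtain ⟨C, hC⟩ := h.exists_cot_sq hn hP rfl
    refine Or.inr (Or.inl ⟨hr, α, m, n, _, C, hn, hP, rfl, _, fun q => rfl, fun q hq => ?_⟩)
    rw [(hκ q hq).2]
    exact hC _ (hκ q hq).1
  · obtain ⟨rfl, rfl⟩ : C₁ = 2 ∧ C₂ = 8 := by simpa [pointP0] using hr
    by_cases h0 : f t₀ = -2
    · exact const (-2) (by norm_num [cubicP]) (by norm_num) h0
    · obtain ⟨C, hC⟩ := h.exists_inv_sq ht₀ h0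
      refine Or.inr (Or.inr (Or.inl ⟨hr, C, fun q hq => ?_⟩))
      rw [(hκ q hq).2]
      exact hC _ (hκ q hq).1
  · obtain ⟨a, b, c, hab, hbc, hP⟩ := exists_factor_of_mem_regionII hr
    have hnonpos := h.cubicP_nonpos ht₀
    rw [hP] at hnonpos
    refine Or.inr (Or.inr (Or.inr (Or.inl ?_)))
    rcases le_or_gt (f t₀) a with ha | ha
    · obtain ⟨C, hC⟩ := h.exists_tan_sq_jacobiAm hab hbc hP ht₀ ha
      refine ⟨hr, a, b, c, C, hab, hbc, hP, _, fun q => rfl, Or.inr fun q hq => ?_⟩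
      rw [(hκ q hq).2]
      exact hC _ (hκ q hq).1
    · have hb : b ≤ f t₀ := by
        by_contra! hlt
        have := mul_pos_of_neg_of_neg
          (mul_neg_of_pos_of_neg (sub_pos.2 ha) (sub_neg.2 hlt)) (sub_neg.2 (hlt.trans hbc))
        linarith
      have hc : f t₀ ≤ c := by
        by_contra! hgt
        have := mul_pos (mul_pos (sub_pos.2 ha) (sub_pos.2 (hbc.trans hgt))) (sub_pos.2 hgt)
        linarith
      obtain ⟨C, hC⟩ := h.exists_sin_sq_jacobiAm hab hbc hP ht₀ hb hc
      refine ⟨hr, a, b, c, C, hab, hbc, hP, _, fun q => rfl, Or.inl fun q hq => ?_⟩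
      rw [(hκ q hq).2]
      exact hC _ (hκ q hq).1
  · obtain ⟨hlt, hC₂⟩ := id hr
    obtain ⟨s, hs, hs', hC₁, hp, -⟩ := curveLPlus_curveLMinus_eq hlt
    simp only at hlt hC₂ hs' hC₁ hp
    have hP : ∀ t : ℝ, cubicP C₁ C₂ t = (t + 2 - s) ^ 2 * (t + 2 + 2 * s) := fun t => by
      rw [hC₂, hp, hC₁, cubicP]
      ring
    by_cases h0 : f t₀ = -2 + s
    · exact const (-2 + s) (by rw [hP]; ring) (by rw [hC₁]; ring) h0
    · have hw : (((2 - C₁) / 2) ^ (1 / 4 : ℝ)) ^ 2 = s / 2 := by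
        refine (sq_eq_sq₀ (by positivity) (by positivity)).1 ?_
        rw [← pow_mul, rpow_one_div_four_pow_four (by linarith), hC₁]
        ring
      obtain ⟨C, hC⟩ := h.exists_tan_sq hs hw hP ht₀ h0
      refine Or.inr (Or.inr (Or.inr (Or.inr (Or.inl ⟨hr, C, _, fun q => rfl, fun q hq => ?_⟩))))
      rw [(hκ q hq).2, hs']
      exact hC _ (hκ q hq).1
  · obtain ⟨hlt, hC₂⟩ := id hr
    obtain ⟨s, hs, hs', hC₁, -, hm⟩ := curveLPlus_curveLMinus_eq hlt
    simp only at hlt hC₂ hs' hC₁ hm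
    have hP : ∀ t : ℝ, cubicP C₁ C₂ t = (t + 2 + s) ^ 2 * (t + 2 - 2 * s) := fun t => by
      rw [hC₂, hm, hC₁, cubicP]
      ring
    have hpos : 0 < 2 - C₁ := by linarith
    have hσ : (2 - C₁) ^ (1 / 4 : ℝ) / 2 ≠ 0 := by positivity
    have hw : ((2 - C₁) ^ (1 / 4 : ℝ) / 2 * (8 : ℝ) ^ (1 / 4 : ℝ)) ^ 2 = s / 2 := by
      refine (sq_eq_sq₀ (by positivity) (by positivity)).1 ?_
      rw [← pow_mul, mul_pow, div_pow, rpow_one_div_four_pow_four hpos.le,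
        rpow_one_div_four_pow_four (by norm_num), hC₁]
      ring
    rcases lt_trichotomy (f t₀) (-2 - s) with h0 | h0 | h0
    · obtain ⟨C, hC⟩ := h.exists_hypCoth_sq hs hσ hw hP ht₀ h0
      refine Or.inr (Or.inr (Or.inr (Or.inr (Or.inr
        ⟨hr, C, _, fun q => rfl, Or.inr fun q hq => ?_⟩))))
      rw [(hκ q hq).2, hs']
      exact hC _ (hκ q hq).1
    · exact const (-2 - s) (by rw [hP]; ring) (by rw [hC₁]; ring) h0
    · obtain ⟨C, hC⟩ := h.exists_tanh_sq hs hσ hw hP ht₀ h0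
      refine Or.inr (Or.inr (Or.inr (Or.inr (Or.inr
        ⟨hr, C, _, fun q => rfl, Or.inl fun q hq => ?_⟩))))
      rw [(hκ q hq).2, hs']
      exact hC _ (hκ q hq).1

/-! ### Partial derivatives in the plane -/

/-- `f` is differentiable at `q` with partial derivatives `a` in `x` and `b` in `y`. -/
def HasPartials (f : ℝ × ℝ → ℝ) (a b : ℝ) (q : ℝ × ℝ) : Prop :=
  HasFDerivAt f (a • ContinuousLinearMap.fst ℝ ℝ ℝ + b • ContinuousLinearMap.snd ℝ ℝ ℝ) q

namespace HasPartials

variable {f g : ℝ × ℝ → ℝ} {a b a' b' : ℝ} {q : ℝ × ℝ}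

theorem partialX_eq (h : HasPartials f a b q) : partialX f q = a := by
  rw [partialX, HasFDerivAt.fderiv h]
  simp

theorem partialY_eq (h : HasPartials f a b q) : partialY f q = b := by
  rw [partialY, HasFDerivAt.fderiv h]
  simp

theorem congr_partials (h : HasPartials f a b q) (ha : a = a') (hb : b = b') :
    HasPartials f a' b' q := by
  rwa [← ha, ← hb]

theorem congr_of_eqOn {Ω : Set (ℝ × ℝ)} (hΩ : IsOpen Ω) (hq : q ∈ Ω) (hfg : EqOn g f Ω)
    (h : HasPartials f a b q) : HasPartials g a b q :=
  HasFDerivAt.congr_of_eventuallyEq h (eventually_of_mem (hΩ.mem_nhds hq) hfg)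

theorem fst (q : ℝ × ℝ) : HasPartials (fun r => r.1) 1 0 q := by
  simpa [HasPartials] using hasFDerivAt_fst (𝕜 := ℝ) (p := q)

theorem snd (q : ℝ × ℝ) : HasPartials (fun r => r.2) 0 1 q := by
  simpa [HasPartials] using hasFDerivAt_snd (𝕜 := ℝ) (p := q)

theorem add (hf : HasPartials f a b q) (hg : HasPartials g a' b' q) :
    HasPartials (fun r => f r + g r) (a + a') (b + b') q := by
  refine (HasFDerivAt.add hf hg).congr_fderiv ?_
  ext <;> simp

theorem mul (hf : HasPartials f a b q) (hg : HasPartials g a' b' q) :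
    HasPartials (fun r => f r * g r) (a * g q + f q * a') (b * g q + f q * b') q := by
  refine (HasFDerivAt.mul hf hg).congr_fderiv ?_
  ext <;> simp <;> ring

theorem const_mul (c : ℝ) (hf : HasPartials f a b q) :
    HasPartials (fun r => c * f r) (c * a) (c * b) q := by
  refine (HasFDerivAt.const_mul hf c).congr_fderiv ?_
  ext <;> simp

theorem comp {φ : ℝ → ℝ} {d : ℝ} (hφ : HasDerivAt φ d (f q)) (hf : HasPartials f a b q) :
    HasPartials (fun r => φ (f r)) (d * a) (d * b) q := by
  refine (hφ.comp_hasFDerivAt q hf).congr_fderiv ?_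
  ext <;> simp

end HasPartials

/-- The function `1 / (x² + y²)`. -/
noncomputable def invNormSq (q : ℝ × ℝ) : ℝ := (q.1 ^ 2 + q.2 ^ 2)⁻¹

theorem sq_add_sq_pos_of_fst_ne_zero {q : ℝ × ℝ} (hq : q.1 ≠ 0) : 0 < q.1 ^ 2 + q.2 ^ 2 := by
  positivity

theorem hasPartials_invNormSq {q : ℝ × ℝ} (hq : q.1 ≠ 0) :
    HasPartials invNormSq (-2 * q.1 * invNormSq q ^ 2) (-2 * q.2 * invNormSq q ^ 2) q := by
  have hpos := sq_add_sq_pos_of_fst_ne_zero hq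
  have h : HasPartials (fun r : ℝ × ℝ => r.1 * r.1 + r.2 * r.2) _ _ q :=
    ((HasPartials.fst q).mul (.fst q)).add ((HasPartials.snd q).mul (.snd q))
  have := HasPartials.comp (φ := fun z => z⁻¹) (hasDerivAt_inv (by nlinarith)) h
  simp only [← pow_two] at this
  refine this.congr_partials ?_ ?_ <;> (unfold invNormSq; field_simp; ring)

theorem hasPartials_angleOf {q : ℝ × ℝ} (hq : q.1 ≠ 0) :
    HasPartials angleOf (-q.2 * invNormSq q) (q.1 * invNormSq q) q := by
  have hpos := sq_add_sq_pos_of_fst_ne_zero hq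
  have h := (HasPartials.snd q).mul
    (HasPartials.comp (φ := fun z => z⁻¹) (hasDerivAt_inv hq) (.fst q))
  have := HasPartials.comp (Real.hasDerivAt_arctan _) h
  refine this.congr_partials ?_ ?_ <;> (unfold invNormSq; field_simp; ring)

/-! ### Reduction of the Navier–Stokes equations -/

/-- For the radial field `(x, y) f(θ) / r²` with pressure `P(θ) / r²` the momentum equations
become, in the radial and the angular direction, `f'' + f² + 2P = 0` and `P' = 2f'`. -/
theorem profile_ode_of_solvesNavierStokes {Ω : Set (ℝ × ℝ)} (hΩ : IsOpen Ω)
    (hx : ∀ q ∈ Ω, q.1 ≠ 0) {u v p : ℝ × ℝ → ℝ} (hNS : SolvesNavierStokes Ω u v p)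
    {f f₁ f₂ P P₁ : ℝ → ℝ}
    (hf : ∀ q ∈ Ω, HasDerivAt f (f₁ (angleOf q)) (angleOf q))
    (hf₁ : ∀ q ∈ Ω, HasDerivAt f₁ (f₂ (angleOf q)) (angleOf q))
    (hP : ∀ q ∈ Ω, HasDerivAt P (P₁ (angleOf q)) (angleOf q))
    (hu : ∀ q ∈ Ω, u q = q.1 * (invNormSq q * f (angleOf q)))
    (hv : ∀ q ∈ Ω, v q = q.2 * (invNormSq q * f (angleOf q)))
    (hp : ∀ q ∈ Ω, p q = invNormSq q * P (angleOf q)) {q : ℝ × ℝ} (hq : q ∈ Ω) :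
    f₂ (angleOf q) = -f (angleOf q) ^ 2 - 2 * P (angleOf q) ∧
      P₁ (angleOf q) = 2 * f₁ (angleOf q) := by
  have dR : ∀ r ∈ Ω, HasPartials invNormSq _ _ r := fun r hr => hasPartials_invNormSq (hx r hr)
  have dR2 : ∀ r ∈ Ω, HasPartials (fun r => invNormSq r * invNormSq r) _ _ r :=
    fun r hr => (dR r hr).mul (dR r hr)
  have dA : ∀ r ∈ Ω, HasPartials (fun r => f (angleOf r)) _ _ r :=
    fun r hr => HasPartials.comp (hf r hr) (hasPartials_angleOf (hx r hr))
  have dB : ∀ r ∈ Ω, HasPartials (fun r => f₁ (angleOf r)) _ _ r :=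
    fun r hr => HasPartials.comp (hf₁ r hr) (hasPartials_angleOf (hx r hr))
  have dp : ∀ r ∈ Ω, HasPartials p _ _ r := fun r hr =>
    ((dR r hr).mul (HasPartials.comp (hP r hr) (hasPartials_angleOf (hx r hr)))).congr_of_eqOn
      hΩ hr hp
  have du : ∀ r ∈ Ω, HasPartials u _ _ r := fun r hr =>
    ((HasPartials.fst r).mul ((dR r hr).mul (dA r hr))).congr_of_eqOn hΩ hr hu
  have dv : ∀ r ∈ Ω, HasPartials v _ _ r := fun r hr =>
    ((HasPartials.snd r).mul ((dR r hr).mul (dA r hr))).congr_of_eqOn hΩ hr hv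
  -- Each first derivative of `u` and `v` has the form `r⁻⁴ (g f + h f')` with quadratic forms `g`
  -- and `h` in `x` and `y`, which gives the second derivatives.
  have comb : ∀ {g h : ℝ × ℝ → ℝ} {a b a' b' : ℝ}, ∀ r ∈ Ω, HasPartials g a b r →
      HasPartials h a' b' r → HasPartials (fun r => invNormSq r * invNormSq r *
        (g r * f (angleOf r) + h r * f₁ (angleOf r))) _ _ r := fun r hr hg hh =>
    (dR2 r hr).mul ((hg.mul (dA r hr)).add (hh.mul (dB r hr)))
  have hxx := fun r : ℝ × ℝ => (HasPartials.fst r).mul (.fst r)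
  have hxy := fun r : ℝ × ℝ => (HasPartials.fst r).mul (.snd r)
  have hyy := fun r : ℝ × ℝ => (HasPartials.snd r).mul (.snd r)
  have hR : ∀ r : ℝ × ℝ, invNormSq r = (r.1 ^ 2 + r.2 ^ 2)⁻¹ := fun _ => rfl
  have dux := (comb q hq ((hyy q).add ((hxx q).const_mul (-1)))
    ((hxy q).const_mul (-1))).congr_of_eqOn (g := partialX u) hΩ hq (fun r hr => by
      rw [(du r hr).partialX_eq]
      have := sq_add_sq_pos_of_fst_ne_zero (hx r hr)
      simp only [hR r]
      field_simp
      ring)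
  have duy := (comb q hq ((hxy q).const_mul (-2)) (hxx q)).congr_of_eqOn
    (g := partialY u) hΩ hq (fun r hr => by
      rw [(du r hr).partialY_eq]
      have := sq_add_sq_pos_of_fst_ne_zero (hx r hr)
      simp only [hR r]
      field_simp
      ring)
  have dvx := (comb q hq ((hxy q).const_mul (-2)) ((hyy q).const_mul (-1))).congr_of_eqOn
    (g := partialX v) hΩ hq (fun r hr => by
      rw [(dv r hr).partialX_eq]
      have := sq_add_sq_pos_of_fst_ne_zero (hx r hr)
      simp only [hR r]
      field_simp
      ring)
  have dvy := (comb q hq ((hxx q).add ((hyy q).const_mul (-1))) (hxy q)).congr_of_eqOn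
    (g := partialY v) hΩ hq (fun r hr => by
      rw [(dv r hr).partialY_eq]
      have := sq_add_sq_pos_of_fst_ne_zero (hx r hr)
      simp only [hR r]
      field_simp
      ring)
  have eX := hNS.momentumX q hq
  have eY := hNS.momentumY q hq
  rw [((du q hq).mul (du q hq)).partialX_eq, ((du q hq).mul (dv q hq)).partialY_eq,
    laplacian2, dux.partialX_eq, duy.partialY_eq, (dp q hq).partialX_eq, hu q hq, hv q hq] at eX
  rw [((dv q hq).mul (du q hq)).partialX_eq, ((dv q hq).mul (dv q hq)).partialY_eq,
    laplacian2, dvx.partialX_eq, dvy.partialY_eq, (dp q hq).partialY_eq, hu q hq, hv q hq] at eY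
  have hpos := sq_add_sq_pos_of_fst_ne_zero (hx q hq)
  set F := f (angleOf q)
  set F₁ := f₁ (angleOf q)
  set F₂ := f₂ (angleOf q)
  set Q := P (angleOf q)
  set Q₁ := P₁ (angleOf q)
  rw [hR q] at eX eY
  have comb₀ : ∀ {X Y : ℝ} (c d : ℝ), X = 0 → Y = 0 → c * X + d * Y = 0 := by
    rintro X Y c d rfl rfl
    ring
  -- `x` times the first plus `y` times the second equation is the radial component, and
  -- `x` times the second minus `y` times the first the angular one.
  have rad : -(F₂ + F ^ 2 + 2 * Q) * (q.1 ^ 2 + q.2 ^ 2)⁻¹ = 0 := by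
    refine Eq.trans ?_ (comb₀ q.1 q.2 eX eY)
    field_simp
    ring
  have ang : (Q₁ - 2 * F₁) * (q.1 ^ 2 + q.2 ^ 2)⁻¹ = 0 := by
    refine Eq.trans ?_ (comb₀ (-q.2) q.1 eX eY)
    field_simp
    ring
  have hne := inv_ne_zero hpos.ne'
  have h1 := (mul_eq_zero.1 rad).resolve_right hne
  have h2 := (mul_eq_zero.1 ang).resolve_right hne
  exact ⟨by linarith, by linarith⟩

/-! ### Profiles of self-similar radial solutions -/

/-- An open cone that misses the axis `x = 0` lies on one side of it. -/
theorem IsOpenCone.fst_div_fst_pos {Ω : Set (ℝ × ℝ)} (hΩ : IsOpenCone Ω)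
    (hx : ∀ q ∈ Ω, q.1 ≠ 0) {q r : ℝ × ℝ} (hq : q ∈ Ω) (hr : r ∈ Ω) : 0 < q.1 / r.1 := by
  have hc := fun {a b : ℝ × ℝ} (ha : a ∈ Ω) (hb : b ∈ Ω) =>
    hΩ.isConnected.isPreconnected.intermediate_value ha hb continuousOn_fst
  have h0 : ∀ {a b : ℝ × ℝ}, a ∈ Ω → b ∈ Ω → ¬(a.1 ≤ 0 ∧ 0 ≤ b.1) := fun ha hb h => by
    obtain ⟨c, hcΩ, hc0⟩ := hc ha hb h
    exact hx c hcΩ hc0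
  rcases lt_or_gt_of_ne (hx q hq) with h1 | h1 <;> rcases lt_or_gt_of_ne (hx r hr) with h2 | h2
  · exact div_pos_of_neg_of_neg h1 h2
  · exact absurd ⟨h1.le, h2.le⟩ (h0 hq hr)
  · exact absurd ⟨h2.le, h1.le⟩ (h0 hr hq)
  · exact div_pos h1 h2

/-- The points of the line `x = c` with angle `t`. -/
noncomputable def slicePoint (c t : ℝ) : ℝ × ℝ := (c, c * Real.tan t)

theorem angleOf_slicePoint {c t : ℝ} (hc : c ≠ 0) (ht : t ∈ Ioo (-(Real.pi / 2)) (Real.pi / 2)) :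
    angleOf (slicePoint c t) = t := by
  rw [angleOf, slicePoint, mul_div_cancel_left₀ _ hc, Real.arctan_tan ht.1 ht.2]

theorem slicePoint_angleOf {c : ℝ} {q : ℝ × ℝ} (hq : q.1 ≠ 0) :
    slicePoint c (angleOf q) = (c / q.1) • q := by
  rw [slicePoint, angleOf, Real.tan_arctan]
  ext <;> simp <;> field_simp

theorem contDiffOn_slicePoint (c : ℝ) :
    ContDiffOn ℝ ∞ (slicePoint c) (Ioo (-(Real.pi / 2)) (Real.pi / 2)) := fun _ ht =>
  (contDiffAt_const.prodMk (contDiffAt_const.mul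
    (Real.contDiffAt_tan.2 (Real.cos_pos_of_mem_Ioo ht).ne'))).contDiffWithinAt

/-- The angles of the points of an open cone that misses the axis `x = 0`. -/
theorem IsOpenCone.image_angleOf {Ω : Set (ℝ × ℝ)} (hΩ : IsOpenCone Ω)
    (hx : ∀ q ∈ Ω, q.1 ≠ 0) {q₀ : ℝ × ℝ} (hq₀ : q₀ ∈ Ω) :
    angleOf '' Ω = Ioo (-(Real.pi / 2)) (Real.pi / 2) ∩ slicePoint q₀.1 ⁻¹' Ω := by
  ext t
  constructor
  · rintro ⟨q, hq, rfl⟩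
    refine ⟨Real.arctan_mem_Ioo _, ?_⟩
    rw [mem_preimage, slicePoint_angleOf (hx q hq)]
    exact hΩ.smul_mem _ (hΩ.fst_div_fst_pos hx hq₀ hq) q hq
  · rintro ⟨ht, htΩ⟩
    exact ⟨_, htΩ, angleOf_slicePoint (hx q₀ hq₀) ht⟩

theorem IsOpenCone.isOpen_image_angleOf {Ω : Set (ℝ × ℝ)} (hΩ : IsOpenCone Ω)
    (hx : ∀ q ∈ Ω, q.1 ≠ 0) : IsOpen (angleOf '' Ω) := by
  obtain ⟨q₀, hq₀⟩ := hΩ.isConnected.nonempty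
  rw [hΩ.image_angleOf hx hq₀]
  exact (contDiffOn_slicePoint q₀.1).continuousOn.isOpen_inter_preimage isOpen_Ioo hΩ.isOpen

theorem IsOpenCone.isPreconnected_image_angleOf {Ω : Set (ℝ × ℝ)} (hΩ : IsOpenCone Ω)
    (hx : ∀ q ∈ Ω, q.1 ≠ 0) : IsPreconnected (angleOf '' Ω) :=
  hΩ.isConnected.isPreconnected.image _ fun q hq =>
    (HasFDerivAt.continuousAt (hasPartials_angleOf (hx q hq))).continuousWithinAt

/-- A smooth function on the cone that is constant along rays is a smooth function of the angle. -/
theorem IsOpenCone.exists_eq_comp_angleOf {Ω : Set (ℝ × ℝ)} (hΩ : IsOpenCone Ω)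
    (hx : ∀ q ∈ Ω, q.1 ≠ 0) {g : ℝ × ℝ → ℝ} (hg : ContDiffOn ℝ ∞ g Ω)
    (hhom : ∀ l : ℝ, 0 < l → ∀ q ∈ Ω, g (l • q) = g q) :
    ∃ f : ℝ → ℝ, ContDiffOn ℝ ∞ f (angleOf '' Ω) ∧ ∀ q ∈ Ω, g q = f (angleOf q) := by
  obtain ⟨q₀, hq₀⟩ := hΩ.isConnected.nonempty
  refine ⟨fun t => g (slicePoint q₀.1 t), ?_, fun q hq => ?_⟩
  · rw [hΩ.image_angleOf hx hq₀]
    exact hg.comp ((contDiffOn_slicePoint q₀.1).mono inter_subset_left) inter_subset_right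
  · simp only [slicePoint_angleOf (hx q hq)]
    rw [hhom _ (hΩ.fst_div_fst_pos hx hq₀ hq) q hq]

theorem ContDiffOn.hasDerivAt_deriv_of_isOpen {f : ℝ → ℝ} {I : Set ℝ} (hf : ContDiffOn ℝ ∞ f I)
    (hI : IsOpen I) {t : ℝ} (ht : t ∈ I) : HasDerivAt f (deriv f t) t :=
  ((hf.differentiableOn (by simp)).differentiableAt (hI.mem_nhds ht)).hasDerivAt

/-- The first integrals: `P - 2f` is a constant `C₁` and `f'² + (2/3) (f³ + 6f² + 6C₁f)` is a
constant, which defines `C₂`. -/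
theorem exists_isProfileOn {I : Set ℝ} (hI : IsOpen I) (hIc : IsPreconnected I)
    (hIn : I.Nonempty) {f f₁ P P₁ : ℝ → ℝ}
    (hf : ∀ t ∈ I, HasDerivAt f (f₁ t) t)
    (hf₁ : ∀ t ∈ I, HasDerivAt f₁ (-f t ^ 2 - 2 * P t) t)
    (hP : ∀ t ∈ I, HasDerivAt P (P₁ t) t) (hP₁ : ∀ t ∈ I, P₁ t = 2 * f₁ t) :
    ∃ C₁ C₂, (∀ t ∈ I, P t = 2 * f t + C₁) ∧ IsProfileOn C₁ C₂ I f f₁ := by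
  have const : ∀ {g : ℝ → ℝ}, (∀ t ∈ I, HasDerivAt g 0 t) → ∃ c, ∀ t ∈ I, g t = c := fun hg =>
    hI.exists_is_const_of_deriv_eq_zero hIc
      (fun t ht => (hg t ht).differentiableAt.differentiableWithinAt) fun t ht => (hg t ht).deriv
  obtain ⟨C₁, hC₁⟩ := const (g := fun t => P t - 2 * f t) fun t ht =>
    ((hP t ht).sub ((hf t ht).const_mul 2)).congr_deriv (by rw [hP₁ t ht, sub_self])
  have hC₁' : ∀ t ∈ I, P t = 2 * f t + C₁ := fun t ht => by linarith [hC₁ t ht]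
  have hf₂ : ∀ t ∈ I, HasDerivAt f₁ (-f t ^ 2 - 4 * f t - 2 * C₁) t := fun t ht =>
    (hf₁ t ht).congr_deriv (by rw [hC₁' t ht]; ring)
  obtain ⟨E, hE⟩ := const
    (g := fun t => 3 / 2 * f₁ t ^ 2 + f t ^ 3 + 6 * f t ^ 2 + 6 * C₁ * f t) fun t ht =>
      ((((((hf₂ t ht).fun_pow 2).const_mul (3 / 2)).add ((hf t ht).fun_pow 3)).add
        (((hf t ht).fun_pow 2).const_mul 6)).add ((hf t ht).const_mul (6 * C₁))).congr_deriv (by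
          norm_num
          ring)
  exact ⟨C₁, -E, hC₁', hI, hIc, hIn, hf, hf₂, fun t ht => by
    unfold cubicP
    linarith [hE t ht]⟩

theorem theorem1p3 (Ω : Set (ℝ × ℝ)) (hΩ : IsOpenCone Ω)
    (hy : Ω ∩ {q : ℝ × ℝ | q.1 = 0} = ∅)
    (u v p : ℝ × ℝ → ℝ)
    (hu : ContDiffOn ℝ ∞ u Ω) (hv : ContDiffOn ℝ ∞ v Ω) (hp : ContDiffOn ℝ ∞ p Ω)
    (hNS : SolvesNavierStokes Ω u v p)
    (hss : IsSelfSimilar Ω u v p)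
    (hnontrivial : ∃ q ∈ Ω, (u q, v q) ≠ (0, 0))
    (hradial : ∀ q ∈ Ω, q.1 * v q = q.2 * u q) :
    ∃ (C₁ C₂ : ℝ) (κ : ℝ × ℝ → ℝ),
      (∀ q ∈ Ω,
        u q = q.1 / (q.1 ^ 2 + q.2 ^ 2) * κ q ∧
        v q = q.2 / (q.1 ^ 2 + q.2 ^ 2) * κ q ∧
        p q = 2 / (q.1 ^ 2 + q.2 ^ 2) * κ q + C₁ / (q.1 ^ 2 + q.2 ^ 2)) ∧
      IsListedProfile Ω C₁ C₂ κ := by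
  have hx : ∀ q ∈ Ω, q.1 ≠ 0 := fun q hq h0 => by
    have : q ∈ Ω ∩ {q : ℝ × ℝ | q.1 = 0} := ⟨hq, h0⟩
    rwa [hy] at this
  have hr : ∀ q ∈ Ω, 0 < q.1 ^ 2 + q.2 ^ 2 := fun q hq => sq_add_sq_pos_of_fst_ne_zero (hx q hq)
  -- `r² u / x` and `r² p` are constant along rays.
  obtain ⟨f, hf, huf⟩ := hΩ.exists_eq_comp_angleOf hx
    (g := fun q => (q.1 ^ 2 + q.2 ^ 2) * u q / q.1)
    ((((contDiffOn_fst.pow 2).add (contDiffOn_snd.pow 2)).mul hu).div contDiffOn_fst hx)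
    fun l hl q hq => by
      have := hx q hq
      simp only [(hss l hl q hq).1, Prod.smul_fst, Prod.smul_snd, smul_eq_mul]
      field_simp
  obtain ⟨P, hP, hpP⟩ := hΩ.exists_eq_comp_angleOf hx
    (g := fun q => (q.1 ^ 2 + q.2 ^ 2) * p q)
    (((contDiffOn_fst.pow 2).add (contDiffOn_snd.pow 2)).mul hp)
    fun l hl q hq => by
      simp only [(hss l hl q hq).2.2, Prod.smul_fst, Prod.smul_snd, smul_eq_mul]
      ring
  have hI := hΩ.isOpen_image_angleOf hx
  have hf₁ : ContDiffOn ℝ ∞ (deriv f) (angleOf '' Ω) := hf.deriv_of_isOpen hI (by simp)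
  have mem : ∀ q ∈ Ω, angleOf q ∈ angleOf '' Ω := fun q hq => mem_image_of_mem _ hq
  have ode : ∀ q ∈ Ω, deriv (deriv f) (angleOf q) = -f (angleOf q) ^ 2 - 2 * P (angleOf q) ∧
      deriv P (angleOf q) = 2 * deriv f (angleOf q) := fun q hq =>
    profile_ode_of_solvesNavierStokes hΩ.isOpen hx hNS
      (fun r hr => hf.hasDerivAt_deriv_of_isOpen hI (mem r hr))
      (fun r hr => hf₁.hasDerivAt_deriv_of_isOpen hI (mem r hr))
      (fun r hr => hP.hasDerivAt_deriv_of_isOpen hI (mem r hr))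
      (fun r hrΩ => by
        have := hx r hrΩ
        have := hr r hrΩ
        rw [← huf r hrΩ, invNormSq]
        field_simp)
      (fun r hrΩ => by
        have := hx r hrΩ
        have := hr r hrΩ
        rw [← huf r hrΩ, invNormSq]
        field_simp
        rw [mul_comm, hradial r hrΩ])
      (fun r hrΩ => by
        have := hr r hrΩ
        rw [← hpP r hrΩ, invNormSq]
        field_simp) hq
  obtain ⟨C₁, C₂, hC₁, hprof⟩ := exists_isProfileOn hI (hΩ.isPreconnected_image_angleOf hx)
    (hΩ.isConnected.nonempty.image _)
    (fun t ht => hf.hasDerivAt_deriv_of_isOpen hI ht)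
    (by
      rintro _ ⟨q, hq, rfl⟩
      exact (hf₁.hasDerivAt_deriv_of_isOpen hI (mem q hq)).congr_deriv (ode q hq).1)
    (fun t ht => hP.hasDerivAt_deriv_of_isOpen hI ht)
    (by
      rintro _ ⟨q, hq, rfl⟩
      exact (ode q hq).2)
  refine ⟨C₁, C₂, fun q => (q.1 ^ 2 + q.2 ^ 2) * u q / q.1, fun q hq => ?_,
    hprof.isListedProfile fun q hq => ⟨mem q hq, huf q hq⟩⟩
  have h1 := hx q hq
  have h2 := hr q hq
  refine ⟨by field_simp, ?_, ?_⟩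
  · field_simp
    linarith [hradial q hq]
  · have h3 : (q.1 ^ 2 + q.2 ^ 2) * p q = 2 * ((q.1 ^ 2 + q.2 ^ 2) * u q / q.1) + C₁ := by
      rw [huf q hq, ← hC₁ _ (mem q hq)]
      exact hpP q hq
    rw [div_mul_eq_mul_div, ← add_div, ← h3]
    field_simp
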